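/- **Theorem 1 (essential self-adjointness of $\hat h_{k,j}$).** Let $l>0$, $a,m,q_e,q_m\in\mathbb{R}$, $z^2=q_e^2+q_m^2$, $\Xi=1+\frac{a^2}{l^2}$, $\Delta_\theta=1+\frac{a^2}{l^2}\cos^2\theta$, and suppose that $$\Delta_r=(r^2+a^2)\Bigl(1-\frac{r^2}{l^2}\Bigr)-2mr+z^2$$ has three positive real zeros $r_-\le r_+<r_c$ (counted with multiplicity), i.e. $0<r_-\le r_+<r_c$ and $\Delta_r=\frac1{l^2}(r_c-r)(r-r_+)(r-r_-)(r+r_c+r_++r_-)$; the extremal case $r_-=r_+$ is included. Let $\mu,e\in\mathbb{R}$ and $k\in\mathbb{Z}+\frac12$. Let $\hat{\mathbb U}_k$ be the angular operator with domain $C_0^\infty(0,\pi)^2$ in $L^2\bigl((0,\pi),\frac{\sin\theta}{\sqrt{\Delta_\theta}}\,d\theta\bigr)^2$ given by $$\mathbb U_k=\begin{pmatrix}-\mu a\cos\theta & i\sqrt{\Delta_\theta}\,(\partial_\theta+\tfrac12\cot\theta+b_k)\\ i\sqrt{\Delta_\theta}\,(\partial_\theta+\tfrac12\cot\theta-b_k)&\mu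 a\cos\theta\end{pmatrix},\qquad b_k(\theta)=\frac{\Xi k}{\Delta_\theta\sin\theta}-\frac{q_m e\cot\theta}{\Delta_\theta}.$$ For $\lambda\in\mathbb{R}$ let $\hat h_{k,\lambda}$ be the operator with domain $C_0^\infty(r_+,r_c)^2$ in $L^2\bigl((r_+,r_c),\frac{r^2+a^2}{\Delta_r}dr\bigr)^2$ given by $$h_{k,\lambda}=\begin{pmatrix}0&\frac{\Delta_r}{r^2+a^2}\partial_r\\-\frac{\Delta_r}{r^2+a^2}\partial_r&0\end{pmatrix}+V(r),\qquad V(r)=\frac1{r^2+a^2}\begin{pmatrix}a\Xi k+eq_er+\mu r\sqrt{\Delta_r}&\lambda\sqrt{\Delta_r}\\ \lambda\sqrt{\Delta_r}&a\Xi k+eq_er-\mu r\sqrt{\Delta_r}\end{pmatrix}.$$ The reduced radial Dirac Hamiltonian of the mode $(k,j)$ is $\hat h_{k,j}=\hat h_{k,\lambda}$ with $\lambda=\lambda_{k;j}$ an eigenvalue of the closure of $\hat{\mathbb U}_k$. Then every eigenvalue of the closure of $\hat{\mathbb U}_k$ is real, and for every $\lambda\in\mathbb{R}$, in particular for every $\lambda=\lambda_{k;j}$: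 1. $\hat h_{k,\lambda}$ is essentially self-adjoint, i.e. it is densely defined and closable and its closure is self-adjoint. 2. For each $r_0\in(r_+,r_c)$ the tortoise coordinate $y(r)=\int_{r_0}^r\frac{s^2+a^2}{\Delta_r(s)}\,ds$ is a bijection of $(r_+,r_c)$ onto $\mathbb{R}$ with $y\to+\infty$ as $r\to r_c$ and $y\to-\infty$ as $r\to r_+$, and in this coordinate $$h_{k,\lambda}=\begin{pmatrix}0&\partial_y\\-\partial_y&0\end{pmatrix}+V(r(y))\quad\text{on }\mathbb{R}.$$ This expression is in the limit point case at $y=+\infty$ and at $y=-\infty$: for every $\zeta\in\mathbb{C}$ there is a solution $Y:\mathbb{R}\to\mathbb{C}^2$ of $h_{k,\lambda}Y=\zeta Y$ that is not square integrable (with respect to $dy$) near $+\infty$, and likewise there is one that is not square integrable near $-\infty$. -/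

import Mathlib

open MeasureTheory Set Filter Topology
open scoped ContDiff Matrix ENNReal

noncomputable section

namespace KNdSDirac

/-! ### First order 2×2 systems and their minimal operators -/

/-- The fibre `ℂ²` with its Hermitian inner product. -/
abbrev C2 : Type := EuclideanSpace ℂ (Fin 2)

/-- The formal differential expression `X ↦ A X' + B X` with matrix coefficients. -/
def firstOrder (A B : ℝ → Matrix (Fin 2) (Fin 2) ℂ) (X : ℝ → C2) (x : ℝ) : C2 :=
  WithLp.toLp 2 (A x *ᵥ WithLp.ofLp (deriv X x) + B x *ᵥ WithLp.ofLp (X x))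

/-- The test functions `C_0^∞(b, c)²`. -/
def testFunctions (b c : ℝ) : Set (ℝ → C2) :=
  {X | ContDiff ℝ ∞ X ∧ HasCompactSupport X ∧ tsupport X ⊆ Ioo b c}

/-- The measure `w(x) dx` on the interval `(b, c)`. -/
def weightedMeasure (w : ℝ → ℝ) (b c : ℝ) : Measure ℝ :=
  (volume.restrict (Ioo b c)).withDensity (fun x => ENNReal.ofReal (w x))

/-- The Hilbert space `L²((b, c), w(x) dx)²`. -/
abbrev weightedL2 (w : ℝ → ℝ) (b c : ℝ) : Type := Lp C2 2 (weightedMeasure w b c)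

lemma firstOrder_add (A B : ℝ → Matrix (Fin 2) (Fin 2) ℂ) {X Y : ℝ → C2}
    (hX : Differentiable ℝ X) (hY : Differentiable ℝ Y) (x : ℝ) :
    firstOrder A B (X + Y) x = firstOrder A B X x + firstOrder A B Y x := by
  have h : deriv (X + Y) x = deriv X x + deriv Y x := deriv_add (hX x) (hY x)
  simp only [firstOrder, h, Pi.add_apply, WithLp.ofLp_add, Matrix.mulVec_add, ← WithLp.toLp_add]
  congr 1
  abel

lemma firstOrder_smul (A B : ℝ → Matrix (Fin 2) (Fin 2) ℂ) {X : ℝ → C2}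
    (hX : Differentiable ℝ X) (z : ℂ) (x : ℝ) :
    firstOrder A B (z • X) x = z • firstOrder A B X x := by
  have h : deriv (z • X) x = z • deriv X x := ((hX x).hasDerivAt.const_smul z).deriv
  simp only [firstOrder, h, Pi.smul_apply, WithLp.ofLp_smul, Matrix.mulVec_smul,
    ← WithLp.toLp_smul, smul_add]

/-- The graph of the operator `X ↦ A X' + B X` with domain `C_0^∞(b, c)²` in
`L²((b, c), w(x) dx)²`. -/
def minimalGraph (A B : ℝ → Matrix (Fin 2) (Fin 2) ℂ) (w : ℝ → ℝ) (b c : ℝ) :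
    Submodule ℂ (weightedL2 w b c × weightedL2 w b c) where
  carrier := {p | ∃ X ∈ testFunctions b c,
    p.1 =ᵐ[weightedMeasure w b c] X ∧ p.2 =ᵐ[weightedMeasure w b c] firstOrder A B X}
  zero_mem' := by
    refine ⟨0, ⟨contDiff_const, HasCompactSupport.zero, by simp⟩,
      Lp.coeFn_zero _ _ _, (Lp.coeFn_zero _ _ _).trans ?_⟩
    refine Filter.Eventually.of_forall fun x => ?_
    have h : deriv (0 : ℝ → C2) x = 0 := deriv_const x 0
    simp [firstOrder, h]
  add_mem' := by
    rintro p q ⟨X, ⟨hX1, hX2, hX3⟩, hpX, hpX'⟩ ⟨Y, ⟨hY1, hY2, hY3⟩, hqY, hqY'⟩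
    refine ⟨X + Y, ⟨hX1.add hY1, hX2.add hY2,
      (tsupport_add X Y).trans (union_subset hX3 hY3)⟩,
      (Lp.coeFn_add _ _).trans (hpX.add hqY), (Lp.coeFn_add _ _).trans ?_⟩
    filter_upwards [hpX', hqY'] with x h1 h2
    rw [Pi.add_apply, h1, h2,
      firstOrder_add A B (hX1.differentiable (by simp)) (hY1.differentiable (by simp))]
  smul_mem' := by
    rintro z p ⟨X, ⟨hX1, hX2, hX3⟩, hpX, hpX'⟩
    refine ⟨z • X, ⟨hX1.const_smul z, hX2.mono (Function.support_const_smul_subset z X),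
      (closure_mono (Function.support_const_smul_subset z X)).trans hX3⟩,
      (Lp.coeFn_smul _ _).trans (hpX.const_smul z), (Lp.coeFn_smul _ _).trans ?_⟩
    filter_upwards [hpX'] with x h1
    rw [Pi.smul_apply, h1, firstOrder_smul A B (hX1.differentiable (by simp))]

/-- The operator `X ↦ A X' + B X` with domain `C_0^∞(b, c)²` in `L²((b, c), w(x) dx)²`. -/
def minimalOp (A B : ℝ → Matrix (Fin 2) (Fin 2) ℂ) (w : ℝ → ℝ) (b c : ℝ) :
    weightedL2 w b c →ₗ.[ℂ] weightedL2 w b c :=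
  (minimalGraph A B w b c).toLinearPMap

/-- For a positive weight the graph is single valued, so that `minimalOp` has this graph. -/
lemma minimalOp_graph (A B : ℝ → Matrix (Fin 2) (Fin 2) ℂ) (w : ℝ → ℝ) (b c : ℝ)
    (hw : Measurable w) (hpos : ∀ x ∈ Ioo b c, 0 < w x) :
    (minimalOp A B w b c).graph = minimalGraph A B w b c := by
  refine Submodule.toLinearPMap_graph_eq _ ?_
  rintro ⟨f, g⟩ ⟨X, ⟨hX, -, -⟩, hfX, hgX⟩ hf
  simp only at hf hfX hgX ⊢
  subst hf
  have h0 : X =ᵐ[weightedMeasure w b c] 0 := hfX.symm.trans (Lp.coeFn_zero _ _ _)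
  have h1 : ∀ᵐ x ∂(volume.restrict (Ioo b c)), X x = 0 := by
    have h2 := (ae_withDensity_iff hw.ennreal_ofReal).1 h0
    filter_upwards [h2, ae_restrict_mem measurableSet_Ioo] with x hx hxm
    exact hx (ENNReal.ofReal_pos.2 (hpos x hxm)).ne'
  have h3 : EqOn X (fun _ => (0 : C2)) (Ioo b c) :=
    Measure.eqOn_open_of_ae_eq h1 isOpen_Ioo hX.continuous.continuousOn continuousOn_const
  have h4 : ∀ᵐ x ∂(weightedMeasure w b c), x ∈ Ioo b c :=
    (withDensity_absolutelyContinuous _ _).ae_le (ae_restrict_mem measurableSet_Ioo)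
  refine (Lp.eq_zero_iff_ae_eq_zero).2 ?_
  filter_upwards [hgX, h4] with x hx hxm
  have h5 : X =ᶠ[𝓝 x] fun _ => (0 : C2) := h3.eventuallyEq_of_mem (isOpen_Ioo.mem_nhds hxm)
  have h6 : deriv X x = 0 := by rw [h5.deriv_eq]; exact deriv_const x 0
  have h7 : X x = 0 := h3 hxm
  simp [hx, firstOrder, h6, h7]

/-- A densely defined closable operator is essentially self-adjoint if its closure is
self-adjoint. -/
def EssentiallySelfAdjoint {H : Type*} [NormedAddCommGroup H] [InnerProductSpace ℂ H]
    [CompleteSpace H] (T : H →ₗ.[ℂ] H) : Prop :=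
  Dense (T.domain : Set H) ∧ T.IsClosable ∧ IsSelfAdjoint T.closure

/-- `z` is an eigenvalue of the (possibly unbounded) operator `T`. -/
def IsEigenvalue {H : Type*} [NormedAddCommGroup H] [InnerProductSpace ℂ H]
    (T : H →ₗ.[ℂ] H) (z : ℂ) : Prop :=
  ∃ S : T.domain, (S : H) ≠ 0 ∧ T S = z • (S : H)

/-! ### Dirac systems on the line -/

/-- The matrix of the system `(Y₁, Y₂) ↦ (Y₂', -Y₁')`. -/
def symplecticJ : Matrix (Fin 2) (Fin 2) ℂ := !![0, 1; -1, 0]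

/-- The Dirac expression `J ∂_y + V(y)` on the real line. -/
def diracLine (V : ℝ → Matrix (Fin 2) (Fin 2) ℂ) : (ℝ → C2) → ℝ → C2 :=
  firstOrder (fun _ => symplecticJ) V

/-- `Y` is a solution on all of `ℝ` of `τ Y = z Y`. -/
def IsSolution (τ : (ℝ → C2) → ℝ → C2) (z : ℂ) (Y : ℝ → C2) : Prop :=
  Differentiable ℝ Y ∧ ∀ t, τ Y t = z • Y t

/-- Limit point case at `+∞`: for every `z ∈ ℂ` some solution of `τ Y = z Y` is not square
integrable near `+∞`. -/
def LimitPointAtTop (τ : (ℝ → C2) → ℝ → C2) : Prop :=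
  ∀ z : ℂ, ∃ Y, IsSolution τ z Y ∧ ∀ t₀ : ℝ, ¬ MemLp Y 2 (volume.restrict (Ioi t₀))

/-- Limit point case at `-∞`. -/
def LimitPointAtBot (τ : (ℝ → C2) → ℝ → C2) : Prop :=
  ∀ z : ℂ, ∃ Y, IsSolution τ z Y ∧ ∀ t₀ : ℝ, ¬ MemLp Y 2 (volume.restrict (Iio t₀))

end KNdSDirac

open KNdSDirac

/-! ### The Kerr–Newman–de Sitter background -/

/-- Parameters of a Kerr–Newman–de Sitter black hole: de Sitter length `l`, rotation parameter
`a`, mass parameter `m`, electric and magnetic charges `qe`, `qm`, such that `Δ_r` has three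
positive real zeros `rMinus ≤ rPlus < rC` counted with multiplicity; the fourth zero is then
`-(rC + rPlus + rMinus)`, since `Δ_r` has no cubic term. -/
structure KNdS where
  l : ℝ
  a : ℝ
  m : ℝ
  qe : ℝ
  qm : ℝ
  rMinus : ℝ
  rPlus : ℝ
  rC : ℝ
  l_pos : 0 < l
  rMinus_pos : 0 < rMinus
  rMinus_le : rMinus ≤ rPlus
  rPlus_lt : rPlus < rC
  zeros : ∀ r : ℝ,
    (r ^ 2 + a ^ 2) * (1 - r ^ 2 / l ^ 2) - 2 * m * r + (qe ^ 2 + qm ^ 2) =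
      1 / l ^ 2 * ((rC - r) * (r - rPlus) * (r - rMinus) * (r + rC + rPlus + rMinus))

namespace KNdS

variable (B : KNdS)

/-- `Δ_r`. -/
def Δr (r : ℝ) : ℝ :=
  (r ^ 2 + B.a ^ 2) * (1 - r ^ 2 / B.l ^ 2) - 2 * B.m * r + (B.qe ^ 2 + B.qm ^ 2)

/-- `Δ_θ`. -/
def Δθ (θ : ℝ) : ℝ := 1 + B.a ^ 2 / B.l ^ 2 * Real.cos θ ^ 2

/-- `Ξ`. -/
def Ξ : ℝ := 1 + B.a ^ 2 / B.l ^ 2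

/-- The weight `(r² + a²) / Δ_r`. -/
def radialWeight (r : ℝ) : ℝ := (r ^ 2 + B.a ^ 2) / B.Δr r

/-- The weight `sin θ / √Δ_θ`. -/
def angularWeight (θ : ℝ) : ℝ := Real.sin θ / √(B.Δθ θ)

/-- The function `b_k(θ)` of the angular operator. -/
def bAngular (e k θ : ℝ) : ℝ :=
  B.Ξ * k / (B.Δθ θ * Real.sin θ) - B.qm * e * Real.cot θ / B.Δθ θ

/-- The coefficient of `∂_θ` in the angular operator `U_k`. -/
def angularA (θ : ℝ) : Matrix (Fin 2) (Fin 2) ℂ :=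
  !![0, Complex.I * ((√(B.Δθ θ) : ℝ) : ℂ);
     Complex.I * ((√(B.Δθ θ) : ℝ) : ℂ), 0]

/-- The matrix potential of the angular operator `U_k`. -/
def angularB (μ e k θ : ℝ) : Matrix (Fin 2) (Fin 2) ℂ :=
  !![((-(μ * B.a * Real.cos θ) : ℝ) : ℂ),
     Complex.I * ((√(B.Δθ θ) * (1 / 2 * Real.cot θ + B.bAngular e k θ) : ℝ) : ℂ);
     Complex.I * ((√(B.Δθ θ) * (1 / 2 * Real.cot θ - B.bAngular e k θ) : ℝ) : ℂ),
     ((μ * B.a * Real.cos θ : ℝ) : ℂ)]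

/-- The angular operator `U_k` on `C_0^∞(0, π)²` in `L²((0, π), sin θ / √Δ_θ dθ)²`. -/
def angularOp (μ e k : ℝ) :
    weightedL2 B.angularWeight 0 Real.pi →ₗ.[ℂ] weightedL2 B.angularWeight 0 Real.pi :=
  minimalOp B.angularA (B.angularB μ e k) B.angularWeight 0 Real.pi

/-- The coefficient of `∂_r` in the radial operator. -/
def radialA (r : ℝ) : Matrix (Fin 2) (Fin 2) ℂ :=
  ((B.Δr r / (r ^ 2 + B.a ^ 2) : ℝ) : ℂ) • symplecticJ

/-- The matrix potential `V(r)` of the radial operator, with separation constant `lam`. -/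
def radialV (μ e k lam r : ℝ) : Matrix (Fin 2) (Fin 2) ℂ :=
  !![(((B.a * B.Ξ * k + e * B.qe * r + μ * r * √(B.Δr r)) / (r ^ 2 + B.a ^ 2) : ℝ) : ℂ),
     ((√(B.Δr r) / (r ^ 2 + B.a ^ 2) * lam : ℝ) : ℂ);
     ((√(B.Δr r) / (r ^ 2 + B.a ^ 2) * lam : ℝ) : ℂ),
     (((B.a * B.Ξ * k + e * B.qe * r - μ * r * √(B.Δr r)) / (r ^ 2 + B.a ^ 2) : ℝ) : ℂ)]

/-- The formal radial Dirac expression `h`. -/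
def radialExpr (μ e k lam : ℝ) : (ℝ → C2) → ℝ → C2 :=
  firstOrder B.radialA (B.radialV μ e k lam)

/-- The reduced radial Hamiltonian on `C_0^∞(r₊, r_c)²` in
`L²((r₊, r_c), (r² + a²) / Δ_r dr)²`. -/
def radialOp (μ e k lam : ℝ) :
    weightedL2 B.radialWeight B.rPlus B.rC →ₗ.[ℂ] weightedL2 B.radialWeight B.rPlus B.rC :=
  minimalOp B.radialA (B.radialV μ e k lam) B.radialWeight B.rPlus B.rC

/-- The tortoise coordinate `y(r)` with `dy = (r² + a²) / Δ_r dr` and `y(r₀) = 0`. -/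
def tortoise (r₀ r : ℝ) : ℝ := ∫ s in r₀..r, B.radialWeight s

/-- The inverse `r(y)` of the tortoise coordinate on `(r₊, r_c)`. -/
def tortoiseInv (r₀ : ℝ) : ℝ → ℝ := Function.invFunOn (B.tortoise r₀) (Ioo B.rPlus B.rC)

/-- The radial expression in the tortoise coordinate, `J ∂_y + V(r(y))`. -/
def tortoiseExpr (μ e k lam r₀ : ℝ) : (ℝ → C2) → ℝ → C2 :=
  diracLine (fun y => B.radialV μ e k lam (B.tortoiseInv r₀ y))

lemma Δr_pos {r : ℝ} (hr : r ∈ Ioo B.rPlus B.rC) : 0 < B.Δr r := by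
  have h1 := B.l_pos
  have h2 := B.rMinus_pos
  have h3 := B.rMinus_le
  obtain ⟨h4, h5⟩ := hr
  rw [Δr, B.zeros r]
  have h6 : 0 < B.rC - r := by linarith
  have h7 : 0 < r - B.rPlus := by linarith
  have h8 : 0 < r - B.rMinus := by linarith
  have h9 : 0 < r + B.rC + B.rPlus + B.rMinus := by linarith
  positivity

lemma Δθ_pos (θ : ℝ) : 0 < B.Δθ θ := by
  unfold Δθ
  positivity

lemma radialOp_graph (μ e k lam : ℝ) : (B.radialOp μ e k lam).graph =
    minimalGraph B.radialA (B.radialV μ e k lam) B.radialWeight B.rPlus B.rC := by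
  refine minimalOp_graph _ _ _ _ _ ?_ fun r hr => ?_
  · unfold radialWeight Δr
    fun_prop
  · have h1 : 0 < r := lt_trans (lt_of_lt_of_le B.rMinus_pos B.rMinus_le) hr.1
    have h2 := B.Δr_pos hr
    unfold radialWeight
    positivity

lemma angularOp_graph (μ e k : ℝ) : (B.angularOp μ e k).graph =
    minimalGraph B.angularA (B.angularB μ e k) B.angularWeight 0 Real.pi := by
  refine minimalOp_graph _ _ _ _ _ ?_ fun θ hθ => ?_
  · unfold angularWeight Δθ
    fun_prop
  · exact div_pos (Real.sin_pos_of_mem_Ioo hθ) (Real.sqrt_pos.2 (B.Δθ_pos θ))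

end KNdS

end

open KNdSDirac

/-! The radial weight is dy/dr for the tortoise coordinate y. Since `Δr` vanishes at least to first
order at both horizons, the weight dominates κ/(rC - r) and κ/(r - rPlus)
(`exists_le_radialWeight`), so y runs over all of ℝ. A double zero at rPlus only strengthens the
divergence. In the coordinate y the radial expression is J ∂_y + V with V real, symmetric,
continuous and bounded. Hence the system is solvable on all of ℝ, and two solutions for the same z
have constant Wronskian.

Limit point case: a fundamental system with Wronskian 1 satisfies 1 ≤ ‖Y‖ ‖Z‖ pointwise. If both
solutions were square integrable on a half line, the constant 1 would be integrable there.

Essential self-adjointness: for a symmetric densely defined operator it suffices that nothing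
nonzero is orthogonal to the range of T - z for z = ±i (`IsFormalAdjoint.essentiallySelfAdjoint`).
If u is orthogonal, testing against cut-off solutions φ Φ shows that the Wronskian of conj u with
every solution Φ is a.e. constant (`exists_wronskian_ae_eq_const`). So conj u is a.e. a smooth
solution v. For it F = Im(conj v₀ · v₁) satisfies F' = ± w ‖v‖² and |F| ≤ ‖v‖². A nonzero value of
the monotone function F would force w to be integrable near one end, so F, and with it v, vanishes
(`solution_eq_zero`).

The angular eigenvalues are real because the minimal angular operator is symmetric and symmetry
passes to the closure; neither its density nor its self-adjointness is needed. -/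

namespace LinearPMap

/-! ### Symmetric operators, their closures and deficiency spaces -/

variable {H : Type*} [NormedAddCommGroup H] [InnerProductSpace ℂ H]

/-- A symmetric partially defined operator has a symmetric closure. -/
lemma IsFormalAdjoint.closure_self {T : H →ₗ.[ℂ] H} (hT : T.IsFormalAdjoint T) :
    T.closure.IsFormalAdjoint T.closure := by
  -- For a non-closable operator `closure` is by convention the operator itself, so no closability
  -- hypothesis is needed.
  by_cases hc : T.IsClosable
  swap
  · rwa [closure_def' hc]
  have key : ∀ p ∈ _root_.closure (T.graph : Set (H × H)),
      ∀ q ∈ _root_.closure (T.graph : Set (H × H)),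
      inner ℂ p.2 q.1 = inner ℂ p.1 q.2 := by
    have h0 : ∀ p ∈ (T.graph : Set (H × H)), ∀ q ∈ (T.graph : Set (H × H)),
        inner ℂ p.2 q.1 = inner ℂ p.1 q.2 := by
      intro p hp q hq
      obtain ⟨x, hx1, hx2⟩ := (mem_graph_iff T).1 hp
      obtain ⟨y, hy1, hy2⟩ := (mem_graph_iff T).1 hq
      rw [← hx1, ← hx2, ← hy1, ← hy2]
      exact hT x y
    intro p hp q hq
    have h1 : ∀ p ∈ (T.graph : Set (H × H)), inner ℂ p.2 q.1 = inner ℂ p.1 q.2 := by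
      intro p hp
      have hcl : _root_.IsClosed {q : H × H | inner ℂ p.2 q.1 = inner ℂ p.1 q.2} :=
        isClosed_eq (by fun_prop) (by fun_prop)
      exact closure_minimal (h0 p hp) hcl hq
    have hcl : _root_.IsClosed {p : H × H | inner ℂ p.2 q.1 = inner ℂ p.1 q.2} :=
      isClosed_eq (by fun_prop) (by fun_prop)
    exact closure_minimal h1 hcl hp
  intro x y
  have hg : (T.closure.graph : Set (H × H)) = _root_.closure (T.graph : Set (H × H)) := by
    rw [← hc.graph_closure_eq_closure_graph]; rfl
  have hm : ∀ x : T.closure.domain,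
      ((x : H), T.closure x) ∈ _root_.closure (T.graph : Set (H × H)) := by
    intro x
    rw [← hg]
    exact T.closure.mem_graph x
  exact key _ (hm x) _ (hm y)

lemma IsFormalAdjoint.eigenvalue_real [CompleteSpace H] {T : H →ₗ.[ℂ] H}
    (hT : T.IsFormalAdjoint T) {z : ℂ} (hz : IsEigenvalue T z) : ∃ lam : ℝ, z = (lam : ℂ) := by
  obtain ⟨S, hS, hTS⟩ := hz
  have h := hT S S
  rw [hTS, inner_smul_left, inner_smul_right] at h
  have h1 : (inner ℂ (S : H) (S : H)) ≠ 0 := inner_self_ne_zero.2 hS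
  obtain ⟨r, hr⟩ := Complex.conj_eq_iff_real.1 (mul_right_cancel₀ h1 h)
  exact ⟨r, hr⟩

/-- For symmetric `S` one has `‖S x - z x‖² = ‖S x‖² + ‖x‖²` when `z = ±i`. -/
lemma IsFormalAdjoint.norm_le_norm_sub {S : H →ₗ.[ℂ] H} (hS : S.IsFormalAdjoint S) {z : ℂ}
    (hz : z = Complex.I ∨ z = -Complex.I) (x : S.domain) :
    ‖((x : H), S x)‖ ≤ ‖S x - z • (x : H)‖ := by
  have hre : z.re = 0 := by rcases hz with rfl | rfl <;> simp
  have hn : ‖z‖ = 1 := by rcases hz with rfl | rfl <;> simp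
  have him : (inner ℂ (S x) (x : H)).im = 0 := by
    have h := hS x x
    rw [← inner_conj_symm] at h
    have h2 := congrArg Complex.im h
    rw [Complex.conj_im] at h2
    have h3 := congrArg Complex.im (inner_conj_symm (𝕜 := ℂ) (S x) (x : H))
    rw [Complex.conj_im] at h3
    linarith
  have h1 : ‖S x - z • (x : H)‖ ^ 2 = ‖S x‖ ^ 2 + ‖(x : H)‖ ^ 2 := by
    rw [@norm_sub_sq ℂ, inner_smul_right, norm_smul, hn]
    simp [him, hre]
  -- The norm on `H × H` is the maximum of the two component norms.
  refine max_le ?_ ?_ <;> refine le_of_sq_le_sq ?_ (norm_nonneg _)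
  · rw [h1]; nlinarith [sq_nonneg ‖S x‖]
  · rw [h1]; nlinarith [sq_nonneg ‖(x : H)‖]

/-- A symmetric densely defined operator with vanishing deficiency spaces is essentially
self-adjoint. -/
theorem IsFormalAdjoint.essentiallySelfAdjoint [CompleteSpace H] {T : H →ₗ.[ℂ] H}
    (hT : T.IsFormalAdjoint T) (hd : Dense (T.domain : Set H))
    (hker : ∀ z : ℂ, z = Complex.I ∨ z = -Complex.I → ∀ u : H,
      (∀ x : T.domain, inner ℂ u (T x - z • (x : H)) = 0) → u = 0) :
    EssentiallySelfAdjoint T := by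
  have hc : T.IsClosable := (adjoint_isClosed hd).isClosable.leIsClosable (hT.le_adjoint hd)
  refine ⟨hd, hc, ?_⟩
  have hle := T.le_closure
  set S := T.closure with hSdef
  have hS : S.IsFormalAdjoint S := hT.closure_self
  have hSd : Dense (S.domain : Set H) := hd.mono hle.1
  have hScl : _root_.IsClosed (S.graph : Set (H × H)) := hc.closure_isClosed
  have : CompleteSpace S.graph := hScl.completeSpace_coe
  have hsurj : ∀ z : ℂ, z = Complex.I ∨ z = -Complex.I → ∀ y : H,
      ∃ x : S.domain, S x - z • (x : H) = y := by
    intro z hz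
    -- On the closed, hence complete, graph S - z is a bounded operator, and it is bounded below by
    -- the norm estimate for z = ±i. Its range is therefore closed; `hker` makes it dense.
    let L : S.graph →L[ℂ] H :=
      (ContinuousLinearMap.snd ℂ H H - z • ContinuousLinearMap.fst ℂ H H).comp S.graph.subtypeL
    have hL : ∀ x : S.domain, L ⟨((x : H), S x), S.mem_graph x⟩ = S x - z • (x : H) :=
      fun x => by simp [L]
    have hrep : ∀ p : S.graph, ∃ x : S.domain, p = ⟨((x : H), S x), S.mem_graph x⟩ := by
      rintro ⟨p, hp⟩
      obtain ⟨x, hx1, hx2⟩ := (mem_graph_iff S).1 hp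
      exact ⟨x, Subtype.ext (Prod.ext hx1.symm hx2.symm)⟩
    have hanti : AntilipschitzWith 1 L := by
      refine L.antilipschitz_of_bound fun p => ?_
      obtain ⟨x, rfl⟩ := hrep p
      rw [hL]
      simpa using hS.norm_le_norm_sub hz x
    have hclosed : _root_.IsClosed (L.range : Set H) :=
      hanti.isClosed_range L.uniformContinuous
    have hperp : (L.range)ᗮ = ⊥ := by
      rw [Submodule.eq_bot_iff]
      intro u hu
      refine hker z hz u fun x => ?_
      rw [Submodule.mem_orthogonal'] at hu
      have h1 : S ⟨x, hle.1 x.2⟩ = T x := (hle.2 rfl).symm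
      rw [← h1]
      exact hu _ ⟨_, hL ⟨x, hle.1 x.2⟩⟩
    have htop : L.range = ⊤ := by
      have : CompleteSpace L.range := hclosed.completeSpace_coe
      rwa [← Submodule.orthogonal_eq_bot_iff]
    intro y
    obtain ⟨p, hp⟩ : y ∈ L.range := htop ▸ Submodule.mem_top
    obtain ⟨x, rfl⟩ := hrep p
    exact ⟨x, (hL x).symm.trans hp⟩
  rw [isSelfAdjoint_def]
  refine (eq_of_le_of_domain_eq (hS.le_adjoint hSd) (le_antisymm (hS.le_adjoint hSd).1 ?_)).symm
  intro y hy
  -- Choose x with (S - i) x = (S* - i) y. Then y - x is annihilated by S* - i, hence orthogonal to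
  -- the range of S + i, which is all of H; so y = x lies in the domain of S.
  obtain ⟨x, hx⟩ := hsurj Complex.I (Or.inl rfl) (S.adjoint ⟨y, hy⟩ - Complex.I • y)
  have h0 : y - (x : H) = 0 := by
    obtain ⟨v, hv⟩ := hsurj (-Complex.I) (Or.inr rfl) (y - (x : H))
    have h1 := adjoint_isFormalAdjoint hSd ⟨y, hy⟩ v
    have h2 := hS x v
    have h3 : S.adjoint ⟨y, hy⟩ = S x - Complex.I • (x : H) + Complex.I • y := by
      rw [hx]; abel
    have h4 : inner ℂ (y - (x : H)) (S v - (-Complex.I) • (v : H)) = 0 := by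
      rw [h3] at h1
      simp only [inner_sub_left, inner_add_left, inner_sub_right, inner_smul_left,
        inner_smul_right, Complex.conj_I] at h1 h2 ⊢
      linear_combination -h1 + h2
    rw [hv] at h4
    exact inner_self_eq_zero.1 h4
  rw [sub_eq_zero.1 h0]
  exact x.2

end LinearPMap

/-! ### Linear differential equations on the whole line -/

open scoped BoundedContinuousFunction in
/-- Global solvability of a linear ODE with bounded continuous coefficients. -/
theorem exists_hasDerivAt_linear_of_bounded {E : Type*} [NormedAddCommGroup E] [NormedSpace ℝ E]
    [CompleteSpace E] {K : ℝ → E →L[ℝ] E} (hK : Continuous K) {L : ℝ} (hL : 0 < L)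
    (hKL : ∀ t, ‖K t‖ ≤ L) (v : E) :
    ∃ Y : ℝ → E, Y 0 = v ∧ ∀ t, HasDerivAt Y (K t (Y t)) t := by
  -- A Bielecki weight: the integral of L g is sinh(2 L t) / 2, at most g / 2 in absolute value. In
  -- the norm sup ‖Y‖ / g the Picard map is then a contraction with factor 1/2 on all of ℝ at once.
  let g : ℝ → ℝ := fun t => Real.cosh (2 * L * t)
  have hg : Continuous g := by fun_prop
  have hgpos : ∀ t, 0 < g t := fun t => Real.cosh_pos _
  have hcont : ∀ Z : ℝ → E, Continuous Z → Continuous fun s => K s (g s • Z s) :=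
    fun Z hZ => hK.clm_apply (hg.smul hZ)
  have hprim : ∀ Z : ℝ → E, Continuous Z →
      Continuous fun t => (g t)⁻¹ • (v + ∫ s in (0 : ℝ)..t, K s (g s • Z s)) := by
    intro Z hZ
    refine (hg.inv₀ fun t => (hgpos t).ne').smul (continuous_const.add ?_)
    exact intervalIntegral.continuous_primitive
      (fun a b => (hcont Z hZ).intervalIntegrable a b) 0
  have hbound : ∀ (Z : ℝ → E) (C : ℝ), (∀ t, ‖Z t‖ ≤ C) → ∀ t,
      ‖∫ s in (0 : ℝ)..t, K s (g s • Z s)‖ ≤ C / 2 * g t := by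
    intro Z C hC t
    have hC0 : 0 ≤ C := (norm_nonneg _).trans (hC 0)
    have h1 : ‖∫ s in (0 : ℝ)..t, K s (g s • Z s)‖ ≤ |∫ s in (0 : ℝ)..t, L * C * g s| := by
      refine intervalIntegral.norm_integral_le_abs_of_norm_le (Filter.Eventually.of_forall ?_)
        ((by fun_prop : Continuous fun s => L * C * g s).intervalIntegrable _ _)
      intro s
      refine ((K s).le_opNorm _).trans ?_
      rw [norm_smul, Real.norm_of_nonneg (hgpos s).le]
      calc ‖K s‖ * (g s * ‖Z s‖) ≤ L * (g s * C) :=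
            mul_le_mul (hKL s) (mul_le_mul_of_nonneg_left (hC s) (hgpos s).le)
              (mul_nonneg (hgpos s).le (norm_nonneg _)) hL.le
        _ = L * C * g s := by ring
    have h2 : ∫ s in (0 : ℝ)..t, L * C * g s = C / 2 * Real.sinh (2 * L * t) := by
      have h3 : ∀ s ∈ uIcc 0 t,
          HasDerivAt (fun s => C / 2 * Real.sinh (2 * L * s)) (L * C * g s) s := by
        intro s _
        have h4 := (((hasDerivAt_id s).const_mul (2 * L)).sinh).const_mul (C / 2)
        refine h4.congr_deriv ?_
        simp only [g, id]
        ring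
      rw [intervalIntegral.integral_eq_sub_of_hasDerivAt h3
        ((by fun_prop : Continuous fun s => L * C * g s).intervalIntegrable _ _)]
      simp
    refine h1.trans ?_
    rw [h2, abs_mul, abs_of_nonneg (by positivity : 0 ≤ C / 2)]
    refine mul_le_mul_of_nonneg_left ?_ (by positivity)
    rw [← abs_of_pos (hgpos t)]
    refine sq_le_sq.1 ?_
    have : g t ^ 2 = _ := Real.cosh_sq (2 * L * t)
    linarith
  -- The Picard map for Y = g Z, written in terms of the bounded function Z.
  let F : (ℝ →ᵇ E) → (ℝ →ᵇ E) := fun Z =>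
    BoundedContinuousFunction.ofNormedAddCommGroup
      (fun t => (g t)⁻¹ • (v + ∫ s in (0 : ℝ)..t, K s (g s • Z s))) (hprim Z Z.continuous)
      (‖v‖ + ‖Z‖ / 2) (by
        intro t
        rw [norm_smul, norm_inv, Real.norm_of_nonneg (hgpos t).le, inv_mul_le_iff₀ (hgpos t)]
        have h1 := hbound Z ‖Z‖ Z.norm_coe_le_norm t
        have h2 : ‖v‖ ≤ ‖v‖ * g t := le_mul_of_one_le_right (norm_nonneg _) (Real.one_le_cosh _)
        calc _ ≤ ‖v‖ + ‖∫ s in (0 : ℝ)..t, K s (g s • Z s)‖ := norm_add_le _ _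
          _ ≤ ‖v‖ * g t + ‖Z‖ / 2 * g t := add_le_add h2 h1
          _ = _ := by ring)
  have hF : ContractingWith (1 / 2) F := by
    refine ⟨by norm_num, LipschitzWith.of_dist_le_mul fun Z₁ Z₂ => ?_⟩
    refine (BoundedContinuousFunction.dist_le (by positivity)).2 fun t => ?_
    have h1 : F Z₁ t - F Z₂ t =
        (g t)⁻¹ • ∫ s in (0 : ℝ)..t, K s (g s • (Z₁ s - Z₂ s)) := by
      simp only [F, BoundedContinuousFunction.coe_ofNormedAddCommGroup]
      rw [← smul_sub, add_sub_add_left_eq_sub,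
        ← intervalIntegral.integral_sub ((hcont Z₁ Z₁.continuous).intervalIntegrable _ _)
        ((hcont Z₂ Z₂.continuous).intervalIntegrable _ _)]
      simp only [smul_sub, map_sub]
    rw [dist_eq_norm, h1, norm_smul, norm_inv, Real.norm_of_nonneg (hgpos t).le,
      inv_mul_le_iff₀ (hgpos t)]
    have h2 := hbound (fun s => Z₁ s - Z₂ s) (dist Z₁ Z₂)
      (fun s => by rw [← dist_eq_norm]; exact BoundedContinuousFunction.dist_coe_le_dist s) t
    refine h2.trans (le_of_eq ?_)
    push_cast
    ring
  let Z := hF.fixedPoint F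
  have hZ : ∀ t, (g t)⁻¹ • (v + ∫ s in (0 : ℝ)..t, K s (g s • Z s)) = Z t := fun t =>
    DFunLike.congr_fun (hF.fixedPoint_isFixedPt) t
  have hZ' : ∀ t, g t • Z t = v + ∫ s in (0 : ℝ)..t, K s (g s • Z s) := by
    intro t
    rw [← hZ t, smul_smul, mul_inv_cancel₀ (hgpos t).ne', one_smul]
  refine ⟨fun t => g t • Z t, (hZ' 0).trans (by simp), fun t => ?_⟩
  have h := ((hcont Z Z.continuous).integral_hasStrictDerivAt 0 t).hasDerivAt.const_add v
  exact h.congr_of_eventuallyEq (Filter.Eventually.of_forall hZ')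

/-! ### Wronskians and the limit point case for Dirac systems on the line -/

namespace KNdSDirac

/-- The Wronskian of two `ℂ²`-valued functions. -/
noncomputable def wronskian (Y Z : ℝ → C2) (t : ℝ) : ℂ := Y t 0 * Z t 1 - Y t 1 * Z t 0

lemma hasDerivAt_coord {Y : ℝ → C2} {Y' : C2} {t : ℝ} (h : HasDerivAt Y Y' t) (i : Fin 2) :
    HasDerivAt (fun s => Y s i) (Y' i) t :=
  ((EuclideanSpace.proj i : C2 →L[ℂ] ℂ).restrictScalars ℝ).hasFDerivAt
    |>.comp_hasDerivAt t h

lemma diracLine_apply_zero (V : ℝ → Matrix (Fin 2) (Fin 2) ℂ) (Y : ℝ → C2) (t : ℝ) :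
    diracLine V Y t 0 = deriv Y t 1 + (V t 0 0 * Y t 0 + V t 0 1 * Y t 1) := by
  simp [diracLine, firstOrder, symplecticJ, dotProduct, Fin.sum_univ_two]

lemma diracLine_apply_one (V : ℝ → Matrix (Fin 2) (Fin 2) ℂ) (Y : ℝ → C2) (t : ℝ) :
    diracLine V Y t 1 = -deriv Y t 0 + (V t 1 0 * Y t 0 + V t 1 1 * Y t 1) := by
  simp [diracLine, firstOrder, symplecticJ, dotProduct, Fin.sum_univ_two]

/-- The Wronskian of two solutions of a Dirac system with symmetric potential is constant. -/
lemma wronskian_eq {V : ℝ → Matrix (Fin 2) (Fin 2) ℂ} (hV : ∀ t, V t 0 1 = V t 1 0) {z : ℂ}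
    {Y Z : ℝ → C2} (hY : IsSolution (diracLine V) z Y) (hZ : IsSolution (diracLine V) z Z)
    (t s : ℝ) : wronskian Y Z t = wronskian Y Z s := by
  have hd : ∀ t, HasDerivAt (wronskian Y Z) 0 t := by
    intro t
    have hy := fun i => hasDerivAt_coord (hY.1 t).hasDerivAt i
    have hz := fun i => hasDerivAt_coord (hZ.1 t).hasDerivAt i
    have h := ((hy 0).mul (hz 1)).sub ((hy 1).mul (hz 0))
    refine h.congr_deriv ?_
    have y0 := congrArg (fun x : C2 => x 0) (hY.2 t)
    have y1 := congrArg (fun x : C2 => x 1) (hY.2 t)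
    have z0 := congrArg (fun x : C2 => x 0) (hZ.2 t)
    have z1 := congrArg (fun x : C2 => x 1) (hZ.2 t)
    simp only [diracLine_apply_zero, diracLine_apply_one, PiLp.smul_apply, smul_eq_mul] at y0 y1 z0 z1
    rw [hV] at y0 z0
    linear_combination -Z t 0 * y0 - Z t 1 * y1 + Y t 0 * z0 + Y t 1 * z1
  exact is_const_of_deriv_eq_zero (fun t => (hd t).differentiableAt) (fun t => (hd t).deriv) t s

lemma norm_wronskian_le (Y Z : ℝ → C2) (t : ℝ) : ‖wronskian Y Z t‖ ≤ ‖Y t‖ * ‖Z t‖ := by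
  refine le_of_sq_le_sq ?_ (by positivity)
  have h1 : ‖wronskian Y Z t‖ ≤ ‖Y t 0‖ * ‖Z t 1‖ + ‖Y t 1‖ * ‖Z t 0‖ := by
    refine (norm_sub_le _ _).trans (le_of_eq ?_)
    rw [norm_mul, norm_mul]
  rw [mul_pow, EuclideanSpace.norm_sq_eq, EuclideanSpace.norm_sq_eq, Fin.sum_univ_two,
    Fin.sum_univ_two]
  have h2 := pow_le_pow_left₀ (norm_nonneg _) h1 2
  -- Lagrange's identity: the square in the hint is exactly the difference between ‖Y‖² ‖Z‖² and the
  -- square of the bound in `h1`.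
  nlinarith [sq_nonneg (‖Y t 0‖ * ‖Z t 0‖ - ‖Y t 1‖ * ‖Z t 1‖)]

/-- Solutions of a Dirac system on the line with bounded continuous potential exist globally. -/
lemma exists_isSolution {V : ℝ → Matrix (Fin 2) (Fin 2) ℂ} (hV : Continuous V) {C : ℝ}
    (hC : ∀ t i j, ‖V t i j‖ ≤ C) (z : ℂ) (v : C2) :
    ∃ Y, IsSolution (diracLine V) z Y ∧ Y 0 = v := by
  let Λ : Matrix (Fin 2) (Fin 2) ℂ →ₗ[ℂ] (C2 →L[ℂ] C2) :=
    (Matrix.toEuclideanCLM (n := Fin 2) (𝕜 := ℂ)).toAlgEquiv.toLinearMap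
  have hΛ : Continuous Λ := LinearMap.continuous_of_finiteDimensional Λ
  -- As J² = -1, the equation J Y' + V Y = z Y reads Y' = J (V - z) Y.
  let M : ℝ → Matrix (Fin 2) (Fin 2) ℂ := fun t => symplecticJ * (V t - z • 1)
  have hM : Continuous M := by fun_prop
  let K : ℝ → C2 →L[ℝ] C2 := fun t => (Λ (M t)).restrictScalars ℝ
  have hK : Continuous K :=
    (ContinuousLinearMap.restrictScalarsL ℂ C2 C2 ℝ ℝ).continuous.comp (hΛ.comp hM)
  have hcomp : IsCompact (Metric.closedBall (0 : Fin 2 → Fin 2 → ℂ) C) :=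
    isCompact_closedBall _ _
  obtain ⟨L, hL⟩ : ∃ L, ∀ t, ‖K t‖ ≤ L := by
    have hf : Continuous fun N : Fin 2 → Fin 2 → ℂ =>
        ‖Λ (symplecticJ * (Matrix.of N - z • 1))‖ := by
      refine (hΛ.comp ?_).norm
      exact Continuous.matrix_mul continuous_const
        ((continuous_id : Continuous fun N : Fin 2 → Fin 2 → ℂ => N).sub continuous_const)
    obtain ⟨L, hL⟩ := (hcomp.image hf).bddAbove
    refine ⟨L, fun t => ?_⟩
    rw [ContinuousLinearMap.norm_restrictScalars]
    refine hL ⟨fun i j => V t i j, ?_, rfl⟩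
    have hC0 : 0 ≤ C := (norm_nonneg _).trans (hC 0 0 0)
    rw [mem_closedBall_zero_iff, pi_norm_le_iff_of_nonneg hC0]
    intro i
    rw [pi_norm_le_iff_of_nonneg hC0]
    exact fun j => hC t i j
  obtain ⟨Y, hY0, hY⟩ := exists_hasDerivAt_linear_of_bounded hK (L := max L 1)
    (lt_max_of_lt_right one_pos) (fun t => (hL t).trans (le_max_left _ _)) v
  refine ⟨Y, ⟨fun t => (hY t).differentiableAt, fun t => ?_⟩, hY0⟩
  have h : deriv Y t = Matrix.toEuclideanCLM (n := Fin 2) (𝕜 := ℂ) (M t) (Y t) := (hY t).deriv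
  have h' : ∀ i, deriv Y t i = (M t *ᵥ WithLp.ofLp (Y t)) i := by
    intro i; rw [h, Matrix.ofLp_toEuclideanCLM]
  ext i
  fin_cases i
  · change diracLine V Y t 0 = _
    rw [diracLine_apply_zero, h']
    simp only [M, symplecticJ, Matrix.mulVec, dotProduct, Fin.sum_univ_two, Matrix.mul_apply]
    simp
    ring
  · change diracLine V Y t 1 = _
    rw [diracLine_apply_one, h']
    simp only [M, symplecticJ, Matrix.mulVec, dotProduct, Fin.sum_univ_two, Matrix.mul_apply]
    simp
    ring

/-- A fundamental system with Wronskian one. -/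
lemma exists_fundamental_system {V : ℝ → Matrix (Fin 2) (Fin 2) ℂ} (hV : Continuous V) {C : ℝ}
    (hC : ∀ t i j, ‖V t i j‖ ≤ C) (hsymm : ∀ t, V t 0 1 = V t 1 0) (z : ℂ) :
    ∃ Y Z, IsSolution (diracLine V) z Y ∧ IsSolution (diracLine V) z Z ∧
      ∀ t, wronskian Y Z t = 1 := by
  obtain ⟨Y, hY, hY0⟩ := exists_isSolution hV hC z (WithLp.toLp 2 ![1, 0])
  obtain ⟨Z, hZ, hZ0⟩ := exists_isSolution hV hC z (WithLp.toLp 2 ![0, 1])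
  refine ⟨Y, Z, hY, hZ, fun t => ?_⟩
  rw [wronskian_eq hsymm hY hZ t 0]
  simp [wronskian, hY0, hZ0]

/-- Two functions with Wronskian one cannot both be square integrable for an infinite measure. -/
lemma not_memLp_of_wronskian_eq_one {Y Z : ℝ → C2} (h : ∀ t, wronskian Y Z t = 1)
    {μ : Measure ℝ} (hμ : μ univ = ⊤) (hY : MemLp Y 2 μ) (hZ : MemLp Z 2 μ) : False := by
  have h1 : Integrable (fun t => ‖Y t‖ * ‖Z t‖) μ := hY.norm.integrable_mul hZ.norm
  have h2 : Integrable (fun _ : ℝ => (1 : ℝ)) μ := by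
    refine h1.mono' aestronglyMeasurable_const (Filter.Eventually.of_forall fun t => ?_)
    have h3 := norm_wronskian_le Y Z t
    rw [h t] at h3
    simpa using h3
  rw [integrable_const_iff] at h2
  rcases h2 with h2 | h2
  · exact one_ne_zero h2
  · exact (measure_ne_top μ univ) hμ

/-- If every solution were square integrable on some half line, both members of a fundamental system
would be so on the smaller of their two half lines. That contradicts the constant Wronskian 1, since
a half line has infinite measure. -/
theorem limitPointAtTop_diracLine {V : ℝ → Matrix (Fin 2) (Fin 2) ℂ} (hV : Continuous V) {C : ℝ}
    (hC : ∀ t i j, ‖V t i j‖ ≤ C) (hsymm : ∀ t, V t 0 1 = V t 1 0) :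
    LimitPointAtTop (diracLine V) := by
  intro z
  obtain ⟨Y, Z, hY, hZ, hW⟩ := exists_fundamental_system hV hC hsymm z
  by_contra! hcon
  obtain ⟨t₁, h₁⟩ := hcon Y hY
  obtain ⟨t₂, h₂⟩ := hcon Z hZ
  refine not_memLp_of_wronskian_eq_one hW (μ := volume.restrict (Ioi (max t₁ t₂))) (by simp)
    (h₁.mono_measure (Measure.restrict_mono (Ioi_subset_Ioi (le_max_left _ _)) le_rfl))
    (h₂.mono_measure (Measure.restrict_mono (Ioi_subset_Ioi (le_max_right _ _)) le_rfl))

theorem limitPointAtBot_diracLine {V : ℝ → Matrix (Fin 2) (Fin 2) ℂ} (hV : Continuous V) {C : ℝ}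
    (hC : ∀ t i j, ‖V t i j‖ ≤ C) (hsymm : ∀ t, V t 0 1 = V t 1 0) :
    LimitPointAtBot (diracLine V) := by
  intro z
  obtain ⟨Y, Z, hY, hZ, hW⟩ := exists_fundamental_system hV hC hsymm z
  by_contra! hcon
  obtain ⟨t₁, h₁⟩ := hcon Y hY
  obtain ⟨t₂, h₂⟩ := hcon Z hZ
  refine not_memLp_of_wronskian_eq_one hW (μ := volume.restrict (Iio (min t₁ t₂))) (by simp)
    (h₁.mono_measure (Measure.restrict_mono (Iio_subset_Iio (min_le_left _ _)) le_rfl))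
    (h₂.mono_measure (Measure.restrict_mono (Iio_subset_Iio (min_le_right _ _)) le_rfl))

end KNdSDirac

namespace KNdSDirac

/-! ### Functions with vanishing weak derivative -/

/-- A compact subset of an open interval lies in a smaller compact interval. -/
lemma _root_.IsCompact.exists_subset_Icc_of_subset_Ioo {b c : ℝ} (hbc : b < c) {K : Set ℝ}
    (hK : IsCompact K) (hKs : K ⊆ Ioo b c) : ∃ b' c', b < b' ∧ b' < c' ∧ c' < c ∧ K ⊆ Icc b' c' := by
  rcases K.eq_empty_or_nonempty with rfl | hne
  · obtain ⟨m, h1, h2⟩ := exists_between hbc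
    obtain ⟨n, h3, h4⟩ := exists_between h2
    exact ⟨m, n, h1, h3, h4, empty_subset _⟩
  · have h1 := hKs (hK.sInf_mem hne)
    have h2 := hKs (hK.sSup_mem hne)
    have h0 : sInf K ≤ sSup K := csInf_le hK.bddBelow (hK.sSup_mem hne)
    -- Moving the left end off `sInf K` keeps the interval nondegenerate even when K is a single
    -- point.
    obtain ⟨m, hm1, hm2⟩ := exists_between h1.1
    refine ⟨m, sSup K, hm1, hm2.trans_le h0, h2.2, fun x hx => ⟨?_, le_csSup hK.bddAbove hx⟩⟩
    exact hm2.le.trans (csInf_le hK.bddBelow hx)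

/-- A test function with vanishing integral is the derivative of a test function. -/
lemma exists_testFunction_deriv_eq {b c : ℝ} (hbc : b < c) {η : ℝ → ℝ} (hη : ContDiff ℝ ∞ η)
    (hηc : HasCompactSupport η) (hηs : tsupport η ⊆ Ioo b c) (hint : ∫ x, η x = 0) :
    ∃ φ : ℝ → ℝ, ContDiff ℝ ∞ φ ∧ HasCompactSupport φ ∧ tsupport φ ⊆ Ioo b c ∧ deriv φ = η := by
  obtain ⟨b', c', h1, h2, h3, hsub⟩ := hηc.isCompact.exists_subset_Icc_of_subset_Ioo hbc hηs
  have hz : ∀ x, x ∉ Icc b' c' → η x = 0 := fun x hx =>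
    image_eq_zero_of_notMem_tsupport fun h => hx (hsub h)
  have hd : ∀ x, HasDerivAt (fun x => ∫ t in b'..x, η t) (η x) x := fun x =>
    (hη.continuous.integral_hasStrictDerivAt b' x).hasDerivAt
  have hderiv : deriv (fun x => ∫ t in b'..x, η t) = η := funext fun x => (hd x).deriv
  have hzero : ∀ x, x ∉ Icc b' c' → ∫ t in b'..x, η t = 0 := by
    intro x hx
    rw [mem_Icc, not_and_or, not_le, not_le] at hx
    rcases hx with hx | hx
    · rw [intervalIntegral.integral_symm, intervalIntegral.integral_of_le hx.le, neg_eq_zero,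
        integral_Ioc_eq_integral_Ioo]
      refine setIntegral_eq_zero_of_forall_eq_zero fun t ht => hz t fun h => ?_
      exact absurd ht.2 (not_lt.2 h.1)
    · rw [intervalIntegral.integral_of_le (h2.trans hx).le, ← integral_Icc_eq_integral_Ioc,
        setIntegral_eq_integral_of_forall_compl_eq_zero, hint]
      intro t ht
      exact hz t fun h => ht ⟨h.1, h.2.trans hx.le⟩
  have hts : tsupport (fun x => ∫ t in b'..x, η t) ⊆ Icc b' c' := by
    refine closure_minimal (fun x hx => ?_) isClosed_Icc
    by_contra hcon
    exact hx (hzero x hcon)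
  refine ⟨_, ?_, HasCompactSupport.intro isCompact_Icc hzero,
    hts.trans (Icc_subset_Ioo h1 h3), hderiv⟩
  rw [contDiff_infty_iff_deriv, hderiv]
  exact ⟨fun x => (hd x).differentiableAt, hη⟩

/-- A locally integrable function with vanishing weak derivative is constant. -/
theorem ae_eq_const_of_integral_deriv_smul_eq_zero {b c : ℝ} (hbc : b < c) {f : ℝ → ℂ}
    (hf : LocallyIntegrableOn f (Ioo b c))
    (h : ∀ φ : ℝ → ℝ, ContDiff ℝ ∞ φ → HasCompactSupport φ → tsupport φ ⊆ Ioo b c →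
      ∫ x, deriv φ x • f x = 0) :
    ∃ C : ℂ, ∀ᵐ x ∂(volume.restrict (Ioo b c)), f x = C := by
  obtain ⟨x₀, hx₀⟩ := nonempty_Ioo.2 hbc
  obtain ⟨ε, hε, hball⟩ := Metric.isOpen_iff.1 isOpen_Ioo x₀ hx₀
  let ψ₀ : ContDiffBump x₀ := ⟨ε / 4, ε / 2, by positivity, by linarith⟩
  let ψ : ℝ → ℝ := ψ₀.normed volume
  have hψ : ContDiff ℝ ∞ ψ := ψ₀.contDiff_normed
  have hψc : HasCompactSupport ψ := ψ₀.hasCompactSupport_normed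
  have hψs : tsupport ψ ⊆ Ioo b c := by
    rw [ψ₀.tsupport_normed_eq]
    exact (Metric.closedBall_subset_ball (by simp [ψ₀]; linarith)).trans hball
  have hψi : ∫ x, ψ x = 1 := ψ₀.integral_normed
  have hint : ∀ φ : ℝ → ℝ, ContDiff ℝ ∞ φ → HasCompactSupport φ → tsupport φ ⊆ Ioo b c →
      Integrable fun x => φ x • f x := by
    intro φ hφ hφc hφs
    have h1 : IntegrableOn f (tsupport φ) := hf.integrableOn_compact_subset hφs hφc
    have h2 : IntegrableOn (fun x => φ x • f x) (tsupport φ) :=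
      h1.continuousOn_smul hφ.continuous.continuousOn hφc
    rwa [integrableOn_iff_integrable_of_support_subset] at h2
    exact (Function.support_smul_subset_left φ f).trans (subset_tsupport φ)
  -- Du Bois-Reymond: φ - (∫ φ) ψ has integral zero, hence is the derivative of a test function. The
  -- hypothesis then gives ∫ φ f = (∫ φ) C.
  let C := ∫ x, ψ x • f x
  refine ⟨C, ?_⟩
  have h3 : ∀ᵐ x, x ∈ Ioo b c → f x - C = 0 := by
    refine isOpen_Ioo.ae_eq_zero_of_integral_contDiff_smul_eq_zero
      (hf.sub ((locallyIntegrable_const C).locallyIntegrableOn _)) ?_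
    intro φ hφ hφc hφs
    have hφi : Integrable φ := hφ.continuous.integrable_of_hasCompactSupport hφc
    have hψi' : Integrable ψ := hψ.continuous.integrable_of_hasCompactSupport hψc
    let I := ∫ x, φ x
    obtain ⟨H, hH, hHc, hHs, hHd⟩ := exists_testFunction_deriv_eq hbc (η := φ - I • ψ)
      (hφ.sub (hψ.const_smul I)) (hφc.sub (hψc.mono (Function.support_const_smul_subset _ _)))
      ((tsupport_sub _ _).trans (union_subset hφs
        ((closure_mono (Function.support_const_smul_subset _ _)).trans hψs)))
      (by
        have h5 : ∫ x, (φ x - I • ψ x) = I - ∫ x, I • ψ x :=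
          integral_sub hφi (hψi'.smul I)
        refine h5.trans ?_
        rw [integral_smul, hψi]
        simp)
    have h4 := h H hH hHc hHs
    rw [hHd] at h4
    simp only [Pi.sub_apply, Pi.smul_apply, sub_smul, smul_assoc] at h4
    have h6 : ∫ x, (φ x • f x - I • ψ x • f x) = (∫ x, φ x • f x) - ∫ x, I • ψ x • f x :=
      integral_sub (hint φ hφ hφc hφs) ((hint ψ hψ hψc hψs).smul I)
    rw [h6, integral_smul] at h4
    simp only [smul_sub]
    rw [integral_sub (hint φ hφ hφc hφs) (hφi.smul_const C), integral_smul_const]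
    exact h4
  rw [ae_restrict_iff' measurableSet_Ioo]
  filter_upwards [h3] with x hx hxm
  exact sub_eq_zero.1 (hx hxm)

/-! ### The weighted measure -/

variable {w : ℝ → ℝ} {b c : ℝ}

lemma integral_weightedMeasure {E : Type*} [NormedAddCommGroup E] [NormedSpace ℝ E]
    (hw : Measurable w) (hpos : ∀ x ∈ Ioo b c, 0 < w x) (g : ℝ → E) :
    ∫ x, g x ∂(weightedMeasure w b c) = ∫ x in Ioo b c, w x • g x := by
  rw [weightedMeasure, integral_withDensity_eq_integral_toReal_smul hw.ennreal_ofReal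
    (Filter.Eventually.of_forall fun x => ENNReal.ofReal_lt_top)]
  refine setIntegral_congr_fun measurableSet_Ioo fun x hx => ?_
  rw [ENNReal.toReal_ofReal (hpos x hx).le]

lemma integrable_weightedMeasure_iff {E : Type*} [NormedAddCommGroup E] [NormedSpace ℝ E]
    (hw : Measurable w) (hpos : ∀ x ∈ Ioo b c, 0 < w x) (g : ℝ → E) :
    Integrable g (weightedMeasure w b c) ↔ IntegrableOn (fun x => w x • g x) (Ioo b c) := by
  rw [weightedMeasure, integrable_withDensity_iff_integrable_smul' hw.ennreal_ofReal
    (Filter.Eventually.of_forall fun x => ENNReal.ofReal_lt_top)]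
  refine integrableOn_congr_fun (fun x hx => ?_) measurableSet_Ioo
  rw [ENNReal.toReal_ofReal (hpos x hx).le]

lemma ae_weightedMeasure_iff (hw : Measurable w) (hpos : ∀ x ∈ Ioo b c, 0 < w x)
    {p : ℝ → Prop} :
    (∀ᵐ x ∂(weightedMeasure w b c), p x) ↔ ∀ᵐ x ∂(volume.restrict (Ioo b c)), p x := by
  rw [weightedMeasure, ae_withDensity_iff hw.ennreal_ofReal]
  refine eventually_congr ?_
  filter_upwards [ae_restrict_mem measurableSet_Ioo] with x hx
  simp [hpos x hx]

/-- Functions with compact support in `(b, c)` that are continuous there lie in the weighted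
`L²` space. -/
lemma memLp_weightedMeasure {E : Type*} [NormedAddCommGroup E] (hw : Measurable w)
    (hpos : ∀ x ∈ Ioo b c, 0 < w x) (hcont : ContinuousOn w (Ioo b c)) {g : ℝ → E} {K : Set ℝ}
    (hK : IsCompact K) (hKs : K ⊆ Ioo b c) (hg : ContinuousOn g (Ioo b c))
    (hgK : ∀ x ∉ K, g x = 0) : MemLp g 2 (weightedMeasure w b c) := by
  have hm : AEStronglyMeasurable g (weightedMeasure w b c) :=
    (hg.aestronglyMeasurable measurableSet_Ioo).mono_ac (withDensity_absolutelyContinuous _ _)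
  rw [memLp_two_iff_integrable_sq_norm hm, integrable_weightedMeasure_iff hw hpos]
  have h1 : IntegrableOn (fun x => w x • ‖g x‖ ^ 2) K :=
    (((hcont.smul (hg.norm.pow 2)).mono hKs).integrableOn_compact hK)
  rw [integrableOn_iff_integrable_of_support_subset] at h1
  · exact h1.integrableOn
  · intro x hx
    by_contra hxK
    exact hx (by simp [hgK x hxK])

/-- Elements of the weighted `L²` space are locally integrable. -/
lemma locallyIntegrableOn_of_memLp {E : Type*} [NormedAddCommGroup E] [NormedSpace ℝ E]
    (hw : Measurable w)
    (hpos : ∀ x ∈ Ioo b c, 0 < w x) (hcont : ContinuousOn w (Ioo b c)) {g : ℝ → E}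
    (hg : MemLp g 2 (weightedMeasure w b c)) : LocallyIntegrableOn g (Ioo b c) := by
  rw [locallyIntegrableOn_iff isOpen_Ioo.isLocallyClosed]
  intro K hKs hK
  have h0 : ∀ x ∈ Ioo b c, w x ≠ 0 := fun x hx => (hpos x hx).ne'
  -- A compact K has finite weighted measure, so its indicator is in L² and g is weighted-integrable
  -- on K by Hölder. Dividing by w, which is continuous and nonzero on K, returns to Lebesgue
  -- measure.
  have h1 : MemLp (K.indicator fun _ => (1 : ℝ)) 2 (weightedMeasure w b c) := by
    refine memLp_indicator_const 2 hK.measurableSet 1 (Or.inr ?_)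
    have h2 : IntegrableOn (fun x => w x) K := (hcont.mono hKs).integrableOn_compact hK
    rw [weightedMeasure, withDensity_apply _ hK.measurableSet,
      Measure.restrict_restrict hK.measurableSet, inter_eq_left.2 hKs]
    exact h2.lintegral_lt_top.ne
  have h3 : Integrable (fun x => (K.indicator (fun _ => (1 : ℝ)) x) • g x)
      (weightedMeasure w b c) := memLp_one_iff_integrable.1 (hg.smul h1)
  rw [integrable_weightedMeasure_iff hw hpos] at h3
  have h4 : IntegrableOn (fun x => (w x)⁻¹ •
      (w x • (K.indicator (fun _ => (1 : ℝ)) x) • g x)) K :=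
    (h3.mono_set hKs).continuousOn_smul ((hcont.mono hKs).inv₀ fun x hx => h0 x (hKs hx)) hK
  refine h4.congr_fun (fun x hx => ?_) hK.measurableSet
  simp [hx, smul_smul, inv_mul_cancel₀ (h0 x (hKs hx))]

end KNdSDirac

namespace KNdSDirac

variable {A B : ℝ → Matrix (Fin 2) (Fin 2) ℂ} {w : ℝ → ℝ} {b c : ℝ}

/-! ### Symmetry and density of the domain -/

lemma firstOrder_apply (A B : ℝ → Matrix (Fin 2) (Fin 2) ℂ) (X : ℝ → C2) (x : ℝ) (i : Fin 2) :
    firstOrder A B X x i = A x i 0 * deriv X x 0 + A x i 1 * deriv X x 1 +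
      (B x i 0 * X x 0 + B x i 1 * X x 1) := by
  fin_cases i <;> simp [firstOrder]

lemma firstOrder_eq_zero_of_notMem_tsupport (A B : ℝ → Matrix (Fin 2) (Fin 2) ℂ) {X : ℝ → C2}
    {x : ℝ} (hx : x ∉ tsupport X) : firstOrder A B X x = 0 := by
  have h1 : X x = 0 := image_eq_zero_of_notMem_tsupport hx
  have h2 : deriv X x = 0 := image_eq_zero_of_notMem_tsupport fun h => hx (tsupport_deriv_subset h)
  simp [firstOrder, h1, h2]

lemma continuousOn_firstOrder {s : Set ℝ} (hA : ContinuousOn A s) (hB : ContinuousOn B s)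
    {X : ℝ → C2} (hX : ContDiff ℝ ∞ X) : ContinuousOn (firstOrder A B X) s := by
  have hd : Continuous (deriv X) := hX.continuous_deriv (by simp)
  have hX' : Continuous X := hX.continuous
  have h1 : ∀ Y : ℝ → C2, Continuous Y → Continuous fun x => WithLp.ofLp (Y x) := fun Y hY =>
    (PiLp.continuous_ofLp 2 _).comp hY
  rw [continuousOn_iff_continuous_domRestrict] at *
  refine (PiLp.continuous_toLp 2 _).comp (Continuous.add ?_ ?_)
  · exact hA.matrix_mulVec ((h1 _ hd).comp continuous_subtype_val)
  · exact hB.matrix_mulVec ((h1 _ hX').comp continuous_subtype_val)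

lemma inner_C2 (x y : C2) :
    inner ℂ x y = (starRingEnd ℂ) (x 0) * y 0 + (starRingEnd ℂ) (x 1) * y 1 := by
  simp [PiLp.inner_apply, Fin.sum_univ_two, mul_comm]

/-- Formal symmetry of the differential expression implies symmetry of the minimal operator. -/
theorem minimalOp_isFormalAdjoint (hw : Measurable w) (hpos : ∀ x ∈ Ioo b c, 0 < w x)
    (hA : ∀ x ∈ Ioo b c, ∀ i j,
      (starRingEnd ℂ) ((w x : ℂ) * A x i j) = -((w x : ℂ) * A x j i))
    (hD : ∀ x ∈ Ioo b c, ∀ i j, HasDerivAt (fun x => (w x : ℂ) * A x i j)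
      ((w x : ℂ) * B x i j - (starRingEnd ℂ) ((w x : ℂ) * B x j i)) x) :
    (minimalOp A B w b c).IsFormalAdjoint (minimalOp A B w b c) := by
  intro x y
  have hx := (minimalOp A B w b c).mem_graph x
  have hy := (minimalOp A B w b c).mem_graph y
  rw [minimalOp_graph A B w b c hw hpos] at hx hy
  obtain ⟨X, ⟨hX, hXc, hXs⟩, hX1, hX2⟩ := hx
  obtain ⟨Y, ⟨hY, hYc, hYs⟩, hY1, hY2⟩ := hy
  simp only at hX1 hX2 hY1 hY2
  have hi1 := L2.integrable_inner (𝕜 := ℂ) (minimalOp A B w b c x) (y : weightedL2 w b c)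
  have hi2 := L2.integrable_inner (𝕜 := ℂ) (x : weightedL2 w b c) (minimalOp A B w b c y)
  rw [← sub_eq_zero, L2.inner_def, L2.inner_def, ← integral_sub hi1 hi2]
  have hae : (fun t => inner ℂ (minimalOp A B w b c x t) ((y : weightedL2 w b c) t) -
      inner ℂ ((x : weightedL2 w b c) t) (minimalOp A B w b c y t)) =ᵐ[weightedMeasure w b c]
      fun t => inner ℂ (firstOrder A B X t) (Y t) - inner ℂ (X t) (firstOrder A B Y t) := by
    filter_upwards [hX1, hX2, hY1, hY2] with t h1 h2 h3 h4
    rw [h1, h2, h3, h4]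
  have hint := (hi1.sub hi2).congr hae
  rw [integral_congr_ae hae, integral_weightedMeasure hw hpos]
  rw [integrable_weightedMeasure_iff hw hpos] at hint
  let Q : ℝ → ℂ := fun t => w t •
    (inner ℂ (firstOrder A B X t) (Y t) - inner ℂ (X t) (firstOrder A B Y t))
  have hQ0 : ∀ t ∉ tsupport X, Q t = 0 := by
    intro t ht
    simp [Q, firstOrder_eq_zero_of_notMem_tsupport A B ht, image_eq_zero_of_notMem_tsupport ht]
  have hQs : Function.support Q ⊆ Ioo b c := fun t ht =>
    hXs (by by_contra hcon; exact ht (hQ0 t hcon))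
  have hQi : Integrable Q := (integrableOn_iff_integrable_of_support_subset hQs).1 hint
  -- The boundary term -X* (wA) Y of the integration by parts. Since wA is anti-Hermitian and (wA)'
  -- = wB - (wB)*, its derivative is Q.
  let P : ℝ → ℂ := fun t => -(
    (starRingEnd ℂ) (X t 0) * ((w t : ℂ) * A t 0 0) * Y t 0 +
    (starRingEnd ℂ) (X t 0) * ((w t : ℂ) * A t 0 1) * Y t 1 +
    (starRingEnd ℂ) (X t 1) * ((w t : ℂ) * A t 1 0) * Y t 0 +
    (starRingEnd ℂ) (X t 1) * ((w t : ℂ) * A t 1 1) * Y t 1)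
  have hP0 : ∀ t ∉ tsupport X, P t = 0 := by
    intro t ht
    simp [P, image_eq_zero_of_notMem_tsupport ht]
  have hPd : ∀ t, HasDerivAt P (Q t) t := by
    intro t
    by_cases ht : t ∈ tsupport X
    · have htI := hXs ht
      have dx : ∀ i, HasDerivAt (fun s => (starRingEnd ℂ) (X s i))
          ((starRingEnd ℂ) (deriv X t i)) t := fun i =>
        (hasDerivAt_coord (hX.differentiable (by simp) t).hasDerivAt i).star
      have dy := fun i => hasDerivAt_coord (hY.differentiable (by simp) t).hasDerivAt i
      have dm := hD t htI
      have ha := hA t htI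
      have h := (((((dx 0).mul (dm 0 0)).mul (dy 0)).add (((dx 0).mul (dm 0 1)).mul (dy 1))).add
        (((dx 1).mul (dm 1 0)).mul (dy 0))).add (((dx 1).mul (dm 1 1)).mul (dy 1)) |>.neg
      refine h.congr_deriv ?_
      simp only [Q, inner_C2, firstOrder_apply, Complex.real_smul, map_add, map_mul,
        Complex.conj_ofReal, Pi.mul_apply] at ha ⊢
      have e00 := ha 0 0
      have e01 := ha 0 1
      have e10 := ha 1 0
      have e11 := ha 1 1
      linear_combination
        -((starRingEnd ℂ) (deriv X t 0) * Y t 0 * e00) - (starRingEnd ℂ) (deriv X t 0) * Y t 1 * e10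
        - (starRingEnd ℂ) (deriv X t 1) * Y t 0 * e01 - (starRingEnd ℂ) (deriv X t 1) * Y t 1 * e11
    -- Nothing is known about the coefficients outside the interval, but P vanishes near every point
    -- off the support of X.
    · rw [hQ0 t ht]
      refine (hasDerivAt_const t (0 : ℂ)).congr_of_eventuallyEq ?_
      filter_upwards [(isClosed_tsupport X).isOpen_compl.mem_nhds ht] with s hs
      exact hP0 s hs
  have hPi : Integrable P :=
    (continuous_iff_continuousAt.2 fun t => (hPd t).continuousAt).integrable_of_hasCompactSupport
      (HasCompactSupport.intro hXc hP0)
  have := integral_eq_zero_of_hasDerivAt_of_integrable hPd hQi hPi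
  rw [← setIntegral_eq_integral_of_forall_compl_eq_zero (s := Ioo b c)] at this
  · exact this
  · intro t ht
    by_contra hcon
    exact ht (hQs hcon)

/-- Every test function represents an element of the domain of the minimal operator. -/
lemma exists_mem_domain_minimalOp (hw : Measurable w) (hpos : ∀ x ∈ Ioo b c, 0 < w x)
    (hwc : ContinuousOn w (Ioo b c)) (hA : ContinuousOn A (Ioo b c))
    (hB : ContinuousOn B (Ioo b c)) {X : ℝ → C2} (hX : X ∈ testFunctions b c) :
    ∃ x : (minimalOp A B w b c).domain, (x : weightedL2 w b c) =ᵐ[weightedMeasure w b c] X ∧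
      minimalOp A B w b c x =ᵐ[weightedMeasure w b c] firstOrder A B X := by
  have h1 : MemLp X 2 (weightedMeasure w b c) :=
    memLp_weightedMeasure hw hpos hwc hX.2.1 hX.2.2 hX.1.continuous.continuousOn
      fun x hx => image_eq_zero_of_notMem_tsupport hx
  have h2 : MemLp (firstOrder A B X) 2 (weightedMeasure w b c) :=
    memLp_weightedMeasure hw hpos hwc hX.2.1 hX.2.2 (continuousOn_firstOrder hA hB hX.1)
      fun x hx => firstOrder_eq_zero_of_notMem_tsupport A B hx
  have h3 : (h1.toLp X, h2.toLp _) ∈ (minimalOp A B w b c).graph := by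
    rw [minimalOp_graph A B w b c hw hpos]
    exact ⟨X, hX, h1.coeFn_toLp, h2.coeFn_toLp⟩
  obtain ⟨x, hx1, hx2⟩ := (LinearPMap.mem_graph_iff _).1 h3
  refine ⟨x, ?_, ?_⟩
  · rw [hx1]; exact h1.coeFn_toLp
  · rw [hx2]; exact h2.coeFn_toLp

/-- Cutting off a smooth function on `(b, c)` yields a test function. -/
lemma smul_mem_testFunctions {φ : ℝ → ℝ} (hφ : ContDiff ℝ ∞ φ) (hφc : HasCompactSupport φ)
    (hφs : tsupport φ ⊆ Ioo b c) {v : ℝ → C2} (hv : ContDiffOn ℝ ∞ v (Ioo b c)) :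
    (fun x => φ x • v x) ∈ testFunctions b c := by
  have hsub : tsupport (fun x => φ x • v x) ⊆ tsupport φ :=
    closure_mono (Function.support_smul_subset_left φ v)
  refine ⟨contDiff_iff_contDiffAt.2 fun x => ?_, hφc.smul_right, hsub.trans hφs⟩
  by_cases hx : x ∈ tsupport φ
  · exact hφ.contDiffAt.smul (hv.contDiffAt (isOpen_Ioo.mem_nhds (hφs hx)))
  · refine (contDiffAt_const (c := (0 : C2))).congr_of_eventuallyEq ?_
    filter_upwards [(isClosed_tsupport φ).isOpen_compl.mem_nhds hx] with s hs
    simp [image_eq_zero_of_notMem_tsupport hs]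

/-- An element orthogonal to the domain is tested against φ eᵢ. This yields ∫ φ w uᵢ = 0 for all
scalar test functions φ, so w uᵢ vanishes almost everywhere by the fundamental lemma of the calculus
of variations. -/
theorem dense_domain_minimalOp (hw : Measurable w) (hpos : ∀ x ∈ Ioo b c, 0 < w x)
    (hwc : ContinuousOn w (Ioo b c)) (hA : ContinuousOn A (Ioo b c))
    (hB : ContinuousOn B (Ioo b c)) :
    Dense ((minimalOp A B w b c).domain : Set (weightedL2 w b c)) := by
  rw [Submodule.dense_iff_topologicalClosure_eq_top, Submodule.topologicalClosure_eq_top_iff,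
    Submodule.eq_bot_iff]
  intro u hu
  rw [Submodule.mem_orthogonal] at hu
  have hloc : LocallyIntegrableOn u (Ioo b c) :=
    locallyIntegrableOn_of_memLp hw hpos hwc (Lp.memLp u)
  have key : ∀ i : Fin 2, ∀ᵐ x, x ∈ Ioo b c → w x • u x i = 0 := by
    intro i
    have hloci : LocallyIntegrableOn (fun x => u x i) (Ioo b c) := fun x hx => by
      obtain ⟨s, hs, hi⟩ := hloc x hx
      exact ⟨s, hs, (EuclideanSpace.proj i : C2 →L[ℂ] ℂ).integrable_comp hi⟩
    refine isOpen_Ioo.ae_eq_zero_of_integral_contDiff_smul_eq_zero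
      (hloci.continuousOn_smul isOpen_Ioo.isLocallyClosed hwc) ?_
    intro φ hφ hφc hφs
    obtain ⟨x, hx, -⟩ := exists_mem_domain_minimalOp hw hpos hwc hA hB
      (smul_mem_testFunctions hφ hφc hφs (v := fun _ => EuclideanSpace.single i 1)
        contDiffOn_const)
    have h := hu x x.2
    rw [L2.inner_def] at h
    have hae : (fun t => inner ℂ ((x : weightedL2 w b c) t) (u t)) =ᵐ[weightedMeasure w b c]
        fun t => φ t • u t i := by
      filter_upwards [hx] with t ht
      rw [ht]
      fin_cases i <;> simp [inner_C2]
    rw [integral_congr_ae hae, integral_weightedMeasure hw hpos,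
      setIntegral_eq_integral_of_forall_compl_eq_zero] at h
    · rw [← h]
      exact integral_congr_ae (Filter.Eventually.of_forall fun t => smul_comm _ _ _)
    · intro t ht
      simp [image_eq_zero_of_notMem_tsupport fun h => ht (hφs h)]
  rw [Lp.eq_zero_iff_ae_eq_zero]
  refine (ae_weightedMeasure_iff hw hpos).2 ?_
  rw [ae_restrict_iff' measurableSet_Ioo]
  filter_upwards [key 0, key 1] with x h0 h1 hx
  have hwx := (hpos x hx).ne'
  ext i
  fin_cases i
  · exact (smul_eq_zero.1 (h0 hx)).resolve_left hwx
  · exact (smul_eq_zero.1 (h1 hx)).resolve_left hwx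

/-! ### Deficiency spaces of Dirac operators -/

/-- An element orthogonal to the range of `T - z` has constant Wronskian with the solutions of
`τ Φ = z Φ`. -/
lemma exists_wronskian_ae_eq_const (hbc : b < c) (hw : Measurable w)
    (hpos : ∀ x ∈ Ioo b c, 0 < w x)
    (hwc : ContinuousOn w (Ioo b c)) (hA : ContinuousOn A (Ioo b c))
    (hB : ContinuousOn B (Ioo b c)) (hJ : ∀ x ∈ Ioo b c, (w x : ℂ) • A x = symplecticJ) {z : ℂ}
    {u : weightedL2 w b c}
    (hu : ∀ x : (minimalOp A B w b c).domain,
      inner ℂ u (minimalOp A B w b c x - z • (x : weightedL2 w b c)) = 0)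
    {Φ : ℝ → C2} (hΦ : ContDiffOn ℝ ∞ Φ (Ioo b c))
    (hsol : ∀ x ∈ Ioo b c, firstOrder A B Φ x = z • Φ x) :
    ∃ C : ℂ, ∀ᵐ x ∂(volume.restrict (Ioo b c)),
      (starRingEnd ℂ) (u x 0) * Φ x 1 - (starRingEnd ℂ) (u x 1) * Φ x 0 = C := by
  have hloc : LocallyIntegrableOn u (Ioo b c) :=
    locallyIntegrableOn_of_memLp hw hpos hwc (Lp.memLp u)
  have hloci : ∀ i, LocallyIntegrableOn (fun x => (starRingEnd ℂ) (u x i)) (Ioo b c) :=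
      fun i x hx => by
    obtain ⟨s, hs, hi⟩ := hloc x hx
    have h1 : IntegrableOn (fun x => u x i) s :=
      (EuclideanSpace.proj i : C2 →L[ℂ] ℂ).integrable_comp hi
    exact ⟨s, hs, Complex.conjCLE.toContinuousLinearMap.integrable_comp h1⟩
  have hΦi : ∀ i, ContinuousOn (fun x => Φ x i) (Ioo b c) := fun i =>
    (EuclideanSpace.proj i : C2 →L[ℂ] ℂ).continuous.comp_continuousOn hΦ.continuousOn
  refine ae_eq_const_of_integral_deriv_smul_eq_zero hbc ?_ ?_
  · exact ((hloci 0).mul_continuousOn (hΦi 1) isOpen_Ioo.isLocallyClosed).sub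
      ((hloci 1).mul_continuousOn (hΦi 0) isOpen_Ioo.isLocallyClosed)
  intro φ hφ hφc hφs
  -- Because Φ solves the equation, (τ - z)(φ Φ) = φ' A Φ. With w A = J, orthogonality becomes ∫ φ'
  -- (conj u₀ · Φ₁ - conj u₁ · Φ₀) = 0: the weak derivative of the Wronskian vanishes.
  obtain ⟨x, hx1, hx2⟩ := exists_mem_domain_minimalOp hw hpos hwc hA hB
    (smul_mem_testFunctions hφ hφc hφs hΦ)
  have h := hu x
  rw [L2.inner_def] at h
  have hae : (fun t => inner ℂ (u t) ((minimalOp A B w b c x - z • (x : weightedL2 w b c) :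
        weightedL2 w b c) t)) =ᵐ[weightedMeasure w b c]
      fun t => inner ℂ (u t)
        (firstOrder A B (fun x => φ x • Φ x) t - z • (φ t • Φ t)) := by
    filter_upwards [hx1, hx2, Lp.coeFn_sub (minimalOp A B w b c x) (z • (x : weightedL2 w b c)),
      Lp.coeFn_smul z (x : weightedL2 w b c)] with t h1 h2 h3 h4
    rw [h3, Pi.sub_apply, h4, Pi.smul_apply, h1, h2]
  rw [integral_congr_ae hae, integral_weightedMeasure hw hpos] at h
  rw [← setIntegral_eq_integral_of_forall_compl_eq_zero (s := Ioo b c), ← h]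
  · refine setIntegral_congr_fun measurableSet_Ioo fun t ht => ?_
    have hd : deriv (fun x => φ x • Φ x) t = φ t • deriv Φ t + deriv φ t • Φ t :=
      ((hφ.differentiable (by simp) t).hasDerivAt.smul
        ((hΦ.differentiableOn (by simp)).differentiableAt
          (isOpen_Ioo.mem_nhds ht)).hasDerivAt).deriv
    have s0 := congrArg (fun v : C2 => v 0) (hsol t ht)
    have s1 := congrArg (fun v : C2 => v 1) (hsol t ht)
    have j := fun i k => congrFun (congrFun (hJ t ht) i) k
    have j00 := j 0 0
    have j01 := j 0 1
    have j10 := j 1 0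
    have j11 := j 1 1
    simp only [symplecticJ, Matrix.smul_apply, smul_eq_mul, Matrix.of_apply, Matrix.cons_val',
      Matrix.cons_val_zero, Matrix.cons_val_one, Matrix.cons_val_fin_one] at j00 j01 j10 j11
    simp only [inner_C2, firstOrder_apply, PiLp.sub_apply, PiLp.smul_apply, PiLp.add_apply, hd,
      Complex.real_smul, smul_eq_mul] at s0 s1 ⊢
    linear_combination
      -((starRingEnd ℂ) (u t 0) * (w t * φ t * s0 + (deriv φ t : ℝ) * (Φ t 0 * j00 + Φ t 1 * j01)))
      - (starRingEnd ℂ) (u t 1) * (w t * φ t * s1 + (deriv φ t : ℝ) * (Φ t 0 * j10 + Φ t 1 * j11))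
  · intro t ht
    have : deriv φ t = 0 :=
      image_eq_zero_of_notMem_tsupport fun h => ht (hφs (tsupport_deriv_subset h))
    simp [this]

/-- A function `F` with `F' = w g`, `|F| ≤ g` and `w g` integrable vanishes if `w` is not
integrable at both ends of the interval. -/
lemma eq_zero_of_abs_le_of_hasDerivAt (hpos : ∀ x ∈ Ioo b c, 0 < w x)
    (hwc : ContinuousOn w (Ioo b c))
    (hright : ∀ x ∈ Ioo b c, ¬ IntegrableOn w (Ioo x c))
    (hleft : ∀ x ∈ Ioo b c, ¬ IntegrableOn w (Ioo b x)) {F g : ℝ → ℝ}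
    (hF : ∀ x ∈ Ioo b c, HasDerivAt F (w x * g x) x) (hFg : ∀ x, |F x| ≤ g x)
    (hint : IntegrableOn (fun x => w x * g x) (Ioo b c)) : ∀ x ∈ Ioo b c, F x = 0 := by
  have hmono : MonotoneOn F (Ioo b c) := by
    refine monotoneOn_of_deriv_nonneg (convex_Ioo b c)
      (fun x hx => (hF x hx).continuousAt.continuousWithinAt) ?_ ?_ <;> rw [interior_Ioo]
    · exact fun x hx => (hF x hx).differentiableAt.differentiableWithinAt
    · intro x hx
      rw [(hF x hx).deriv]
      exact mul_nonneg (hpos x hx).le ((abs_nonneg _).trans (hFg x))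
  have key : ∀ s ⊆ Ioo b c, MeasurableSet s → ∀ δ > 0, (∀ x ∈ s, δ ≤ |F x|) →
      IntegrableOn w s := by
    intro s hs hsm δ hδ h
    have h1 : IntegrableOn (fun x => δ⁻¹ * (w x * g x)) s := (hint.mono_set hs).const_mul _
    refine Integrable.mono' h1 ((hwc.mono hs).aestronglyMeasurable hsm) ?_
    refine (ae_restrict_iff' hsm).2 (Filter.Eventually.of_forall fun x hx => ?_)
    have hwx := hpos x (hs hx)
    rw [Real.norm_of_nonneg hwx.le, le_inv_mul_iff₀ hδ, mul_comm]
    exact mul_le_mul_of_nonneg_left ((h x hx).trans (hFg x)) hwx.le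
  intro x hx
  by_contra hne
  -- F is monotone, so a negative value bounds |F| below everywhere to the left and a positive value
  -- everywhere to the right. There g ≥ |F| is bounded below, and integrability of w g passes to w.
  rcases lt_or_gt_of_ne hne with h | h
  · refine hleft x hx (key _ (Ioo_subset_Ioo_right hx.2.le) measurableSet_Ioo (-F x)
      (by linarith) fun t ht => ?_)
    have := hmono ⟨ht.1, ht.2.trans hx.2⟩ hx ht.2.le
    exact (neg_le_neg this).trans (neg_le_abs _)
  · refine hright x hx (key _ (Ioo_subset_Ioo_left hx.1.le) measurableSet_Ioo (F x)
      h fun t ht => ?_)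
    have := hmono hx ⟨hx.1.trans ht.1, ht.2⟩ ht.1.le
    exact this.trans (le_abs_self _)

/-- Square integrable solutions of `τ v = z v` with `z = ±i` vanish. -/
lemma solution_eq_zero (hpos : ∀ x ∈ Ioo b c, 0 < w x) (hwc : ContinuousOn w (Ioo b c))
    (hright : ∀ x ∈ Ioo b c, ¬ IntegrableOn w (Ioo x c))
    (hleft : ∀ x ∈ Ioo b c, ¬ IntegrableOn w (Ioo b x))
    (hJ : ∀ x ∈ Ioo b c, (w x : ℂ) • A x = symplecticJ)
    (hBreal : ∀ x i j, (starRingEnd ℂ) (B x i j) = B x i j) (hBsymm : ∀ x, B x 0 1 = B x 1 0)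
    {z : ℂ} (hz : z = Complex.I ∨ z = -Complex.I) {v : ℝ → C2}
    (hv : DifferentiableOn ℝ v (Ioo b c))
    (hsol : ∀ x ∈ Ioo b c, firstOrder A B v x = z • v x)
    (hint : IntegrableOn (fun x => w x * ‖v x‖ ^ 2) (Ioo b c)) : ∀ x ∈ Ioo b c, v x = 0 := by
  -- Up to the factor 2i this is the Wronskian of conj v and v. For real symmetric B, conj v solves
  -- the equation for conj z, so only the Im z term survives in F'.
  let F : ℝ → ℝ := fun x => ((starRingEnd ℂ) (v x 0) * v x 1).im
  have hF : ∀ x ∈ Ioo b c, HasDerivAt F (z.im * (w x * ‖v x‖ ^ 2)) x := by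
    intro x hx
    have d := fun i => hasDerivAt_coord
      (hv.differentiableAt (isOpen_Ioo.mem_nhds hx)).hasDerivAt i
    have d0 : HasDerivAt (fun s => (starRingEnd ℂ) (v s 0)) ((starRingEnd ℂ) (deriv v x 0)) x :=
      (d 0).star
    have h := Complex.imCLM.hasFDerivAt.comp_hasDerivAt x (d0.mul (d 1))
    refine h.congr_deriv ?_
    have s0 := congrArg (fun v : C2 => w x * v 0) (hsol x hx)
    have s1 := congrArg (fun v : C2 => w x * v 1) (hsol x hx)
    have j := fun i k => congrFun (congrFun (hJ x hx) i) k
    have j00 := j 0 0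
    have j01 := j 0 1
    have j10 := j 1 0
    have j11 := j 1 1
    simp only [symplecticJ, Matrix.smul_apply, smul_eq_mul, Matrix.of_apply, Matrix.cons_val',
      Matrix.cons_val_zero, Matrix.cons_val_one, Matrix.cons_val_fin_one] at j00 j01 j10 j11
    simp only [firstOrder_apply, PiLp.smul_apply, smul_eq_mul] at s0 s1
    have e1 : deriv v x 1 = w x * ((z - B x 0 0) * v x 0 - B x 0 1 * v x 1) := by
      linear_combination s0 - deriv v x 0 * j00 - deriv v x 1 * j01
    have e0 : deriv v x 0 = w x * (B x 0 1 * v x 0 - (z - B x 1 1) * v x 1) := by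
      rw [hBsymm]
      linear_combination -s1 + deriv v x 0 * j10 + deriv v x 1 * j11
    have r := fun i k => Complex.conj_eq_iff_im.1 (hBreal x i k)
    rw [EuclideanSpace.norm_sq_eq, Fin.sum_univ_two, e0, e1, Complex.sq_norm, Complex.sq_norm,
      Complex.normSq_apply, Complex.normSq_apply]
    simp only [Complex.imCLM_apply, Complex.add_im, Complex.mul_im, Complex.mul_re,
      Complex.conj_re, Complex.conj_im, Complex.sub_re, Complex.sub_im, Complex.ofReal_re,
      Complex.ofReal_im, r]
    ring
  have hFg : ∀ x, |F x| ≤ ‖v x‖ ^ 2 := by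
    intro x
    refine (Complex.abs_im_le_norm _).trans ?_
    rw [norm_mul, RCLike.norm_conj, EuclideanSpace.norm_sq_eq, Fin.sum_univ_two]
    nlinarith [sq_nonneg (‖v x 0‖ - ‖v x 1‖), sq_nonneg (‖v x 0‖), sq_nonneg (‖v x 1‖)]
  have him : z.im * z.im = 1 := by rcases hz with rfl | rfl <;> simp
  have hone : |z.im| = 1 := by rcases hz with rfl | rfl <;> simp
  -- Multiplying by Im z = ±1 makes the derivative + w ‖v‖² for both signs of z.
  have h0 : ∀ x ∈ Ioo b c, z.im * F x = 0 := by
    refine eq_zero_of_abs_le_of_hasDerivAt hpos hwc hright hleft (g := fun x => ‖v x‖ ^ 2)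
      (fun x hx => ?_) (fun x => ?_) hint
    · refine ((hF x hx).const_mul z.im).congr_deriv ?_
      rw [← mul_assoc, him, one_mul]
    · rw [abs_mul, hone, one_mul]
      exact hFg x
  intro x hx
  have h1 : HasDerivAt (fun x => z.im * F x) 0 x :=
    (hasDerivAt_const x (0 : ℝ)).congr_of_eventuallyEq
      (Filter.eventuallyEq_of_mem (isOpen_Ioo.mem_nhds hx) h0)
  have h2 := h1.unique ((hF x hx).const_mul z.im)
  rw [← mul_assoc, him, one_mul] at h2
  have h3 := (mul_eq_zero.1 h2.symm).resolve_left (hpos x hx).ne'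
  simpa using h3

/-- A Dirac operator on an interval whose weight is not integrable at both ends is essentially
self-adjoint. -/
theorem essentiallySelfAdjoint_minimalOp (hbc : b < c) (hw : Measurable w)
    (hpos : ∀ x ∈ Ioo b c, 0 < w x)
    (hwc : ContinuousOn w (Ioo b c)) (hA : ContinuousOn A (Ioo b c))
    (hB : ContinuousOn B (Ioo b c))
    (hright : ∀ x ∈ Ioo b c, ¬ IntegrableOn w (Ioo x c))
    (hleft : ∀ x ∈ Ioo b c, ¬ IntegrableOn w (Ioo b x))
    (hJ : ∀ x ∈ Ioo b c, (w x : ℂ) • A x = symplecticJ)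
    (hBreal : ∀ x i j, (starRingEnd ℂ) (B x i j) = B x i j) (hBsymm : ∀ x, B x 0 1 = B x 1 0)
    (hfund : ∀ z : ℂ, ∃ Φ Ψ : ℝ → C2, ContDiffOn ℝ ∞ Φ (Ioo b c) ∧ ContDiffOn ℝ ∞ Ψ (Ioo b c) ∧
      (∀ x ∈ Ioo b c, firstOrder A B Φ x = z • Φ x) ∧
      (∀ x ∈ Ioo b c, firstOrder A B Ψ x = z • Ψ x) ∧ ∀ x ∈ Ioo b c, wronskian Φ Ψ x = 1) :
    EssentiallySelfAdjoint (minimalOp A B w b c) := by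
  have hentry : ∀ x ∈ Ioo b c, ∀ i j, (w x : ℂ) * A x i j = symplecticJ i j := fun x hx i j =>
    congrFun (congrFun (hJ x hx) i) j
  refine LinearPMap.IsFormalAdjoint.essentiallySelfAdjoint
    (minimalOp_isFormalAdjoint hw hpos ?_ ?_) (dense_domain_minimalOp hw hpos hwc hA hB) ?_
  · intro x hx i j
    rw [hentry x hx, hentry x hx]
    fin_cases i <;> fin_cases j <;> simp [symplecticJ]
  · intro x hx i j
    have hsymm : B x i j = B x j i := by
      fin_cases i <;> fin_cases j <;> simp [hBsymm]
    rw [map_mul, Complex.conj_ofReal, hBreal, hsymm, sub_self]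
    refine (hasDerivAt_const x (symplecticJ i j)).congr_of_eventuallyEq ?_
    exact Filter.eventuallyEq_of_mem (isOpen_Ioo.mem_nhds hx) fun y hy => hentry y hy i j
  · intro z hz u hu
    obtain ⟨Φ, Ψ, hΦ, hΨ, hΦs, hΨs, hW⟩ := hfund z
    obtain ⟨C₁, h₁⟩ := exists_wronskian_ae_eq_const hbc hw hpos hwc hA hB hJ hu hΦ hΦs
    obtain ⟨C₂, h₂⟩ := exists_wronskian_ae_eq_const hbc hw hpos hwc hA hB hJ hu hΨ hΨs
    -- Cramer's rule: with W(Φ, Ψ) = 1, the two constant Wronskians C₁ and C₂ determine conj u as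
    -- this combination, which is a genuine solution for z.
    let v : ℝ → C2 := fun x => C₂ • Φ x - C₁ • Ψ x
    have hv : DifferentiableOn ℝ v (Ioo b c) :=
      ((hΦ.differentiableOn (by simp)).const_smul C₂).sub
        ((hΨ.differentiableOn (by simp)).const_smul C₁)
    have hvs : ∀ x ∈ Ioo b c, firstOrder A B v x = z • v x := by
      intro x hx
      have hd : ∀ f : ℝ → C2, ContDiffOn ℝ ∞ f (Ioo b c) → HasDerivAt f (deriv f x) x :=
        fun f hf => ((hf.differentiableOn (by simp)).differentiableAt
          (isOpen_Ioo.mem_nhds hx)).hasDerivAt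
      have h1 : deriv v x = C₂ • deriv Φ x - C₁ • deriv Ψ x :=
        (((hd Φ hΦ).const_smul C₂).sub ((hd Ψ hΨ).const_smul C₁)).deriv
      ext i
      have e1 := congrArg (fun v : C2 => v i) (hΦs x hx)
      have e2 := congrArg (fun v : C2 => v i) (hΨs x hx)
      simp only [firstOrder_apply, h1, v, PiLp.sub_apply, PiLp.smul_apply, smul_eq_mul] at e1 e2 ⊢
      linear_combination C₂ * e1 - C₁ * e2
    have hnorm : ∀ᵐ x ∂(volume.restrict (Ioo b c)), ‖v x‖ = ‖u x‖ := by
      filter_upwards [h₁, h₂, ae_restrict_mem measurableSet_Ioo] with x e1 e2 hx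
      have hWx := hW x hx
      unfold wronskian at hWx
      have v0 : v x 0 = (starRingEnd ℂ) (u x 0) := by
        simp only [v, PiLp.sub_apply, PiLp.smul_apply, smul_eq_mul, ← e1, ← e2]
        linear_combination (starRingEnd ℂ) (u x 0) * hWx
      have v1 : v x 1 = (starRingEnd ℂ) (u x 1) := by
        simp only [v, PiLp.sub_apply, PiLp.smul_apply, smul_eq_mul, ← e1, ← e2]
        linear_combination (starRingEnd ℂ) (u x 1) * hWx
      rw [EuclideanSpace.norm_eq, EuclideanSpace.norm_eq, Fin.sum_univ_two, Fin.sum_univ_two,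
        v0, v1, RCLike.norm_conj, RCLike.norm_conj]
    have hint : IntegrableOn (fun x => w x * ‖v x‖ ^ 2) (Ioo b c) := by
      have h3 := (memLp_two_iff_integrable_sq_norm (Lp.aestronglyMeasurable u)).1 (Lp.memLp u)
      rw [integrable_weightedMeasure_iff hw hpos] at h3
      refine h3.congr ?_
      filter_upwards [hnorm] with x hx
      rw [hx, smul_eq_mul]
    have hv0 := solution_eq_zero hpos hwc hright hleft hJ hBreal hBsymm hz hv hvs hint
    rw [Lp.eq_zero_iff_ae_eq_zero]
    refine (ae_weightedMeasure_iff hw hpos).2 ?_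
    filter_upwards [hnorm, ae_restrict_mem measurableSet_Ioo] with x hx hxm
    rw [hv0 x hxm, norm_zero] at hx
    exact norm_eq_zero.1 hx.symm

end KNdSDirac

namespace KNdS

variable (B : KNdS)

/-! ### The tortoise coordinate -/

lemma rPlus_pos : 0 < B.rPlus := B.rMinus_pos.trans_le B.rMinus_le

lemma pos_of_mem {r : ℝ} (hr : r ∈ Ioo B.rPlus B.rC) : 0 < r := B.rPlus_pos.trans hr.1

lemma contDiff_Δr : ContDiff ℝ ∞ B.Δr := by
  unfold Δr
  fun_prop

lemma radialWeight_pos {r : ℝ} (hr : r ∈ Ioo B.rPlus B.rC) : 0 < B.radialWeight r := by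
  have h1 := B.pos_of_mem hr
  have h2 := B.Δr_pos hr
  unfold radialWeight
  positivity

lemma measurable_radialWeight : Measurable B.radialWeight := by
  unfold radialWeight Δr
  fun_prop

lemma contDiffOn_radialWeight : ContDiffOn ℝ ∞ B.radialWeight (Ioo B.rPlus B.rC) :=
  ContDiffOn.div (by fun_prop) B.contDiff_Δr.contDiffOn fun r hr => (B.Δr_pos hr).ne'

/-- `Δ_r` vanishes at least to first order at `r_+` and at `r_c`. -/
lemma exists_Δr_le : ∃ C > 0, ∀ r ∈ Ioo B.rPlus B.rC,
    B.Δr r ≤ C * (B.rC - r) ∧ B.Δr r ≤ C * (r - B.rPlus) := by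
  have hl := B.l_pos
  have hp := B.rPlus_pos
  have hm := B.rMinus_pos
  have hle := B.rMinus_le
  have hlt := B.rPlus_lt
  have hc : 0 < B.rC := hp.trans hlt
  -- In each estimate one factor vanishing at a horizon is kept. Two other factors are bounded by
  -- rC, and the factor with the negative zero by 4 rC.
  refine ⟨1 / B.l ^ 2 * (B.rC * B.rC * (4 * B.rC)), by positivity, fun r hr => ?_⟩
  obtain ⟨h1, h2⟩ := hr
  have e : B.Δr r = _ := B.zeros r
  have p1 : 0 < B.rC - r := by linarith
  have p2 : 0 < r - B.rPlus := by linarith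
  have p3 : 0 < r - B.rMinus := by linarith
  have p4 : 0 < r + B.rC + B.rPlus + B.rMinus := by linarith
  have q1 : B.rC - r ≤ B.rC := by linarith
  have q2 : r - B.rPlus ≤ B.rC := by linarith
  have q3 : r - B.rMinus ≤ B.rC := by linarith
  have q4 : r + B.rC + B.rPlus + B.rMinus ≤ 4 * B.rC := by linarith
  rw [e, mul_assoc (1 / B.l ^ 2), mul_assoc (1 / B.l ^ 2)]
  constructor <;> refine mul_le_mul_of_nonneg_left ?_ (by positivity)
  · calc (B.rC - r) * (r - B.rPlus) * (r - B.rMinus) * (r + B.rC + B.rPlus + B.rMinus)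
        ≤ (B.rC - r) * B.rC * B.rC * (4 * B.rC) := by gcongr
      _ = _ := by ring
  · calc (B.rC - r) * (r - B.rPlus) * (r - B.rMinus) * (r + B.rC + B.rPlus + B.rMinus)
        ≤ B.rC * (r - B.rPlus) * B.rC * (4 * B.rC) := by gcongr
      _ = _ := by ring

/-- The weight has non-integrable singularities at both horizons. -/
lemma exists_le_radialWeight : ∃ κ > 0, ∀ r ∈ Ioo B.rPlus B.rC,
    κ / (B.rC - r) ≤ B.radialWeight r ∧ κ / (r - B.rPlus) ≤ B.radialWeight r := by
  obtain ⟨C, hC, h⟩ := B.exists_Δr_le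
  have hp := B.rPlus_pos
  refine ⟨B.rPlus ^ 2 / C, by positivity, fun r hr => ?_⟩
  obtain ⟨h1, h2⟩ := h r hr
  have hΔ := B.Δr_pos hr
  have p1 : 0 < B.rC - r := sub_pos.2 hr.2
  have p2 : 0 < r - B.rPlus := sub_pos.2 hr.1
  have hn : B.rPlus ^ 2 ≤ r ^ 2 + B.a ^ 2 := by nlinarith [sq_nonneg B.a, hr.1]
  unfold radialWeight
  rw [div_div, div_div]
  exact ⟨div_le_div₀ (by positivity) hn hΔ h1, div_le_div₀ (by positivity) hn hΔ h2⟩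

variable {r₀ : ℝ}

lemma hasDerivAt_tortoise (hr₀ : r₀ ∈ Ioo B.rPlus B.rC) {r : ℝ} (hr : r ∈ Ioo B.rPlus B.rC) :
    HasDerivAt (B.tortoise r₀) (B.radialWeight r) r := by
  have hcont := B.contDiffOn_radialWeight.continuousOn
  refine intervalIntegral.integral_hasDerivAt_right ?_ ?_ ?_
  · refine (hcont.mono ?_).intervalIntegrable
    exact ordConnected_Ioo.uIcc_subset hr₀ hr
  · exact hcont.stronglyMeasurableAtFilter isOpen_Ioo r hr
  · exact hcont.continuousAt (isOpen_Ioo.mem_nhds hr)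

lemma continuousOn_tortoise (hr₀ : r₀ ∈ Ioo B.rPlus B.rC) :
    ContinuousOn (B.tortoise r₀) (Ioo B.rPlus B.rC) := fun _ hr =>
  (B.hasDerivAt_tortoise hr₀ hr).continuousAt.continuousWithinAt

lemma strictMonoOn_tortoise (hr₀ : r₀ ∈ Ioo B.rPlus B.rC) :
    StrictMonoOn (B.tortoise r₀) (Ioo B.rPlus B.rC) := by
  refine strictMonoOn_of_deriv_pos (convex_Ioo _ _) (B.continuousOn_tortoise hr₀) ?_
  rw [interior_Ioo]
  intro r hr
  rw [(B.hasDerivAt_tortoise hr₀ hr).deriv]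
  exact B.radialWeight_pos hr

lemma tortoise_self : B.tortoise r₀ r₀ = 0 := intervalIntegral.integral_same

/-- The bound κ/(rC - r) on the weight makes y + κ log(rC - r) increasing, so y grows at least like
-κ log(rC - r). -/
lemma tendsto_tortoise_rC (hr₀ : r₀ ∈ Ioo B.rPlus B.rC) :
    Tendsto (B.tortoise r₀) (𝓝[<] B.rC) atTop := by
  obtain ⟨κ, hκ, h⟩ := B.exists_le_radialWeight
  have hmono : MonotoneOn (fun r => B.tortoise r₀ r + κ * Real.log (B.rC - r))
      (Ioo B.rPlus B.rC) := by
    have hd : ∀ r ∈ Ioo B.rPlus B.rC,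
        HasDerivAt (fun r => B.tortoise r₀ r + κ * Real.log (B.rC - r))
          (B.radialWeight r - κ / (B.rC - r)) r := by
      intro r hr
      have h1 := ((hasDerivAt_id r).const_sub B.rC).log (sub_pos.2 hr.2).ne'
      refine ((B.hasDerivAt_tortoise hr₀ hr).add (h1.const_mul κ)).congr_deriv ?_
      simp only [id]
      ring
    refine monotoneOn_of_deriv_nonneg (convex_Ioo _ _)
      (fun r hr => (hd r hr).continuousAt.continuousWithinAt) ?_ ?_ <;> rw [interior_Ioo]
    · exact fun r hr => (hd r hr).differentiableAt.differentiableWithinAt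
    · intro r hr
      rw [(hd r hr).deriv]
      exact sub_nonneg.2 (h r hr).1
  have hlim : Tendsto (fun r => -(κ * Real.log (B.rC - r)) + κ * Real.log (B.rC - r₀))
      (𝓝[<] B.rC) atTop := by
    refine tendsto_atTop_add_const_right _ _ (tendsto_neg_atBot_atTop.comp ?_)
    refine Tendsto.const_mul_atBot hκ (Real.tendsto_log_nhdsGT_zero.comp ?_)
    refine tendsto_nhdsWithin_iff.2 ⟨?_, ?_⟩
    · have : Tendsto (fun r => B.rC - r) (𝓝 B.rC) (𝓝 (B.rC - B.rC)) :=
        (continuous_const.sub continuous_id).tendsto _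
      rw [sub_self] at this
      exact this.mono_left nhdsWithin_le_nhds
    · filter_upwards [self_mem_nhdsWithin] with r hr
      exact sub_pos.2 (mem_Iio.1 hr)
  refine tendsto_atTop_mono' _ ?_ hlim
  filter_upwards [Ioo_mem_nhdsLT hr₀.2] with r hr
  have := hmono hr₀ ⟨hr₀.1.trans hr.1, hr.2⟩ hr.1.le
  simp only [tortoise_self] at this
  linarith

lemma tendsto_tortoise_rPlus (hr₀ : r₀ ∈ Ioo B.rPlus B.rC) :
    Tendsto (B.tortoise r₀) (𝓝[>] B.rPlus) atBot := by
  obtain ⟨κ, hκ, h⟩ := B.exists_le_radialWeight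
  have hmono : MonotoneOn (fun r => B.tortoise r₀ r - κ * Real.log (r - B.rPlus))
      (Ioo B.rPlus B.rC) := by
    have hd : ∀ r ∈ Ioo B.rPlus B.rC,
        HasDerivAt (fun r => B.tortoise r₀ r - κ * Real.log (r - B.rPlus))
          (B.radialWeight r - κ / (r - B.rPlus)) r := by
      intro r hr
      have h1 := ((hasDerivAt_id r).sub_const B.rPlus).log (sub_pos.2 hr.1).ne'
      refine ((B.hasDerivAt_tortoise hr₀ hr).sub (h1.const_mul κ)).congr_deriv ?_
      simp only [id]
      ring
    refine monotoneOn_of_deriv_nonneg (convex_Ioo _ _)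
      (fun r hr => (hd r hr).continuousAt.continuousWithinAt) ?_ ?_ <;> rw [interior_Ioo]
    · exact fun r hr => (hd r hr).differentiableAt.differentiableWithinAt
    · intro r hr
      rw [(hd r hr).deriv]
      exact sub_nonneg.2 (h r hr).2
  have hlim : Tendsto (fun r => κ * Real.log (r - B.rPlus) + -(κ * Real.log (r₀ - B.rPlus)))
      (𝓝[>] B.rPlus) atBot := by
    refine tendsto_atBot_add_const_right _ _ ?_
    refine Tendsto.const_mul_atBot hκ (Real.tendsto_log_nhdsGT_zero.comp ?_)
    refine tendsto_nhdsWithin_iff.2 ⟨?_, ?_⟩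
    · have : Tendsto (fun r => r - B.rPlus) (𝓝 B.rPlus) (𝓝 (B.rPlus - B.rPlus)) :=
        (continuous_id.sub continuous_const).tendsto _
      rw [sub_self] at this
      exact this.mono_left nhdsWithin_le_nhds
    · filter_upwards [self_mem_nhdsWithin] with r hr
      exact sub_pos.2 (mem_Ioi.1 hr)
  refine tendsto_atBot_mono' _ ?_ hlim
  filter_upwards [Ioo_mem_nhdsGT hr₀.1] with r hr
  have := hmono ⟨hr.1, hr.2.trans hr₀.2⟩ hr₀ hr.2.le
  simp only [tortoise_self] at this
  linarith

theorem bijOn_tortoise (hr₀ : r₀ ∈ Ioo B.rPlus B.rC) :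
    BijOn (B.tortoise r₀) (Ioo B.rPlus B.rC) univ := by
  refine ⟨mapsTo_univ _ _, (B.strictMonoOn_tortoise hr₀).injOn, ?_⟩
  exact (B.continuousOn_tortoise hr₀).surjOn_of_tendsto (nonempty_Ioo.2 B.rPlus_lt)
    ((tendsto_comp_coe_Ioo_atBot B.rPlus_lt).2 (B.tendsto_tortoise_rPlus hr₀))
    ((tendsto_comp_coe_Ioo_atTop B.rPlus_lt).2 (B.tendsto_tortoise_rC hr₀))

lemma tortoiseInv_mem (hr₀ : r₀ ∈ Ioo B.rPlus B.rC) (y : ℝ) :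
    B.tortoiseInv r₀ y ∈ Ioo B.rPlus B.rC :=
  Function.invFunOn_mem ((B.bijOn_tortoise hr₀).surjOn (mem_univ y))

lemma tortoise_tortoiseInv (hr₀ : r₀ ∈ Ioo B.rPlus B.rC) (y : ℝ) :
    B.tortoise r₀ (B.tortoiseInv r₀ y) = y :=
  Function.invFunOn_eq ((B.bijOn_tortoise hr₀).surjOn (mem_univ y))

lemma tortoiseInv_tortoise (hr₀ : r₀ ∈ Ioo B.rPlus B.rC) {r : ℝ} (hr : r ∈ Ioo B.rPlus B.rC) :
    B.tortoiseInv r₀ (B.tortoise r₀ r) = r :=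
  (B.bijOn_tortoise hr₀).injOn (B.tortoiseInv_mem hr₀ _) hr (B.tortoise_tortoiseInv hr₀ _)

lemma strictMono_tortoiseInv (hr₀ : r₀ ∈ Ioo B.rPlus B.rC) : StrictMono (B.tortoiseInv r₀) := by
  intro y₁ y₂ h
  rw [← (B.strictMonoOn_tortoise hr₀).lt_iff_lt (B.tortoiseInv_mem hr₀ _)
    (B.tortoiseInv_mem hr₀ _), B.tortoise_tortoiseInv hr₀, B.tortoise_tortoiseInv hr₀]
  exact h

lemma continuous_tortoiseInv (hr₀ : r₀ ∈ Ioo B.rPlus B.rC) : Continuous (B.tortoiseInv r₀) := by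
  -- A strictly monotone function whose image is open has no jumps; this gives continuity of the
  -- inverse.
  have himg : B.tortoiseInv r₀ '' univ = Ioo B.rPlus B.rC := by
    refine Subset.antisymm (image_subset_iff.2 fun y _ => B.tortoiseInv_mem hr₀ y) fun r hr => ?_
    exact ⟨B.tortoise r₀ r, mem_univ _, B.tortoiseInv_tortoise hr₀ hr⟩
  rw [← continuousOn_univ]
  intro y _
  refine ((B.strictMono_tortoiseInv hr₀).strictMonoOn univ
    |>.continuousAt_of_image_mem_nhds univ_mem ?_).continuousWithinAt
  rw [himg]
  exact isOpen_Ioo.mem_nhds (B.tortoiseInv_mem hr₀ y)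

lemma hasDerivAt_tortoiseInv (hr₀ : r₀ ∈ Ioo B.rPlus B.rC) (y : ℝ) :
    HasDerivAt (B.tortoiseInv r₀) (B.radialWeight (B.tortoiseInv r₀ y))⁻¹ y :=
  (B.hasDerivAt_tortoise hr₀ (B.tortoiseInv_mem hr₀ y)).of_local_left_inverse
    (B.continuous_tortoiseInv hr₀).continuousAt
    (B.radialWeight_pos (B.tortoiseInv_mem hr₀ y)).ne'
    (Filter.Eventually.of_forall (B.tortoise_tortoiseInv hr₀))

/-- Taken with base point r itself, the tortoise coordinate is the integral of the positive weight
from r. It would be bounded by the full integral, yet it tends to infinity. -/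
lemma not_integrableOn_radialWeight_right {r : ℝ} (hr : r ∈ Ioo B.rPlus B.rC) :
    ¬ IntegrableOn B.radialWeight (Ioo r B.rC) := by
  intro hint
  have hlim := B.tendsto_tortoise_rC hr
  obtain ⟨s, hs1, hs2⟩ := ((hlim.eventually_gt_atTop (∫ s in Ioo r B.rC, B.radialWeight s)).and
    (Ioo_mem_nhdsLT hr.2)).exists
  refine absurd hs1 (not_lt.2 ?_)
  rw [tortoise, intervalIntegral.integral_of_le hs2.1.le]
  refine setIntegral_mono_set hint ?_ (Ioc_subset_Ioo_right hs2.2).eventuallyLE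
  refine (ae_restrict_iff' measurableSet_Ioo).2 (Filter.Eventually.of_forall fun x hx => ?_)
  exact (B.radialWeight_pos ⟨hr.1.trans hx.1, hx.2⟩).le

lemma not_integrableOn_radialWeight_left {r : ℝ} (hr : r ∈ Ioo B.rPlus B.rC) :
    ¬ IntegrableOn B.radialWeight (Ioo B.rPlus r) := by
  intro hint
  have hlim := B.tendsto_tortoise_rPlus hr
  obtain ⟨s, hs1, hs2⟩ := ((hlim.eventually_lt_atBot
    (-∫ s in Ioo B.rPlus r, B.radialWeight s)).and (Ioo_mem_nhdsGT hr.1)).exists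
  refine absurd hs1 (not_lt.2 ?_)
  rw [tortoise, intervalIntegral.integral_symm, intervalIntegral.integral_of_le hs2.2.le,
    integral_Ioc_eq_integral_Ioo]
  refine neg_le_neg (setIntegral_mono_set hint ?_ (Ioo_subset_Ioo_left hs2.1.le).eventuallyLE)
  refine (ae_restrict_iff' measurableSet_Ioo).2 (Filter.Eventually.of_forall fun x hx => ?_)
  exact (B.radialWeight_pos ⟨hx.1, hx.2.trans hr.2⟩).le

/-! ### The radial operator -/

/-- The square root is smooth because `Δr` is positive on the open interval. This smoothness lets
cut-off solutions serve as C^∞ test functions. -/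
lemma contDiffOn_radialV_entry (μ e k lam : ℝ) (i j : Fin 2) :
    ContDiffOn ℝ ∞ (fun r => B.radialV μ e k lam r i j) (Ioo B.rPlus B.rC) := by
  have hd : ∀ r ∈ Ioo B.rPlus B.rC, r ^ 2 + B.a ^ 2 ≠ 0 := fun r hr => by
    have := B.pos_of_mem hr
    positivity
  have hsq : ContDiffOn ℝ ∞ (fun r => √(B.Δr r)) (Ioo B.rPlus B.rC) :=
    B.contDiff_Δr.contDiffOn.sqrt fun r hr => (B.Δr_pos hr).ne'
  fin_cases i <;> fin_cases j <;>
  · refine Complex.ofRealCLM.contDiff.comp_contDiffOn ?_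
    first
    | exact ContDiffOn.div (by fun_prop) (by fun_prop) hd
    | exact (ContDiffOn.div hsq (by fun_prop) hd).mul contDiffOn_const

lemma radialV_conj (μ e k lam r : ℝ) (i j : Fin 2) :
    (starRingEnd ℂ) (B.radialV μ e k lam r i j) = B.radialV μ e k lam r i j := by
  fin_cases i <;> fin_cases j <;> exact Complex.conj_ofReal _

lemma radialV_symm (μ e k lam r : ℝ) :
    B.radialV μ e k lam r 0 1 = B.radialV μ e k lam r 1 0 := rfl

/-- The entries extend continuously to the closed interval: √Δr stays continuous at the zeros of
`Δr`, and r² + a² is bounded away from zero. Compactness then gives the bound. -/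
lemma exists_norm_radialV_le (μ e k lam : ℝ) : ∃ C, ∀ r ∈ Ioo B.rPlus B.rC, ∀ i j,
    ‖B.radialV μ e k lam r i j‖ ≤ C := by
  have hd : ∀ r ∈ Icc B.rPlus B.rC, r ^ 2 + B.a ^ 2 ≠ 0 := fun r hr => by
    have := B.rPlus_pos.trans_le hr.1
    positivity
  have hΔ := B.contDiff_Δr.continuous
  have hc : ∀ i j, ContinuousOn (fun r => B.radialV μ e k lam r i j) (Icc B.rPlus B.rC) := by
    intro i j
    fin_cases i <;> fin_cases j <;>
    · refine Complex.continuous_ofReal.comp_continuousOn ?_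
      first
      | exact ContinuousOn.div (by fun_prop) (by fun_prop) hd
      | exact (ContinuousOn.div (by fun_prop) (by fun_prop) hd).mul continuousOn_const
  choose C hC using fun i j => isCompact_Icc.exists_bound_of_continuousOn (hc i j)
  refine ⟨∑ i, ∑ j, |C i j|, fun r hr i j => ?_⟩
  refine (hC i j r (Ioo_subset_Icc_self hr)).trans ((le_abs_self _).trans ?_)
  refine (Finset.single_le_sum (f := fun j => |C i j|) (fun _ _ => abs_nonneg _)
    (Finset.mem_univ j)).trans ?_
  exact Finset.single_le_sum (f := fun i => ∑ j, |C i j|)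
    (fun _ _ => Finset.sum_nonneg fun _ _ => abs_nonneg _) (Finset.mem_univ i)

lemma continuousOn_radialV (μ e k lam : ℝ) :
    ContinuousOn (B.radialV μ e k lam) (Ioo B.rPlus B.rC) :=
  continuousOn_pi.2 fun i => continuousOn_pi.2 fun j =>
    (B.contDiffOn_radialV_entry μ e k lam i j).continuousOn

lemma continuous_radialV_tortoiseInv (hr₀ : r₀ ∈ Ioo B.rPlus B.rC) (μ e k lam : ℝ) :
    Continuous fun y => B.radialV μ e k lam (B.tortoiseInv r₀ y) :=
  (B.continuousOn_radialV μ e k lam).comp_continuous (B.continuous_tortoiseInv hr₀)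
    (B.tortoiseInv_mem hr₀)

lemma radialWeight_smul_radialA {r : ℝ} (hr : r ∈ Ioo B.rPlus B.rC) :
    (B.radialWeight r : ℂ) • B.radialA r = symplecticJ := by
  have h1 := (B.Δr_pos hr).ne'
  have h2 := B.pos_of_mem hr
  have h3 : r ^ 2 + B.a ^ 2 ≠ 0 := by positivity
  have h4 : B.radialWeight r * (B.Δr r / (r ^ 2 + B.a ^ 2)) = 1 := by
    unfold radialWeight
    field_simp
  rw [radialA, smul_smul, ← Complex.ofReal_mul, h4, Complex.ofReal_one, one_smul]

lemma radialA_eq (r : ℝ) : B.radialA r = (((B.radialWeight r)⁻¹ : ℝ) : ℂ) • symplecticJ := by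
  rw [radialA, radialWeight, inv_div]

lemma continuousOn_radialA : ContinuousOn B.radialA (Ioo B.rPlus B.rC) := by
  have h : ContinuousOn (fun r => (((B.radialWeight r)⁻¹ : ℝ) : ℂ)) (Ioo B.rPlus B.rC) :=
    Complex.continuous_ofReal.comp_continuousOn
      (B.contDiffOn_radialWeight.continuousOn.inv₀ fun r hr => (B.radialWeight_pos hr).ne')
  exact (h.smul continuousOn_const).congr fun r _ => B.radialA_eq r

/-- The radial expression in the tortoise coordinate. -/
theorem tortoiseExpr_comp (hr₀ : r₀ ∈ Ioo B.rPlus B.rC) (μ e k lam : ℝ) {X : ℝ → C2}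
    (hX : DifferentiableOn ℝ X (Ioo B.rPlus B.rC)) (y : ℝ) :
    B.tortoiseExpr μ e k lam r₀ (X ∘ B.tortoiseInv r₀) y =
      B.radialExpr μ e k lam X (B.tortoiseInv r₀ y) := by
  have hd : deriv (X ∘ B.tortoiseInv r₀) y =
      (B.radialWeight (B.tortoiseInv r₀ y))⁻¹ • deriv X (B.tortoiseInv r₀ y) :=
    ((hX.differentiableAt (isOpen_Ioo.mem_nhds (B.tortoiseInv_mem hr₀ y))).hasDerivAt.scomp y
      (B.hasDerivAt_tortoiseInv hr₀ y)).deriv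
  ext i
  simp only [tortoiseExpr, radialExpr, diracLine, firstOrder_apply, hd, radialA_eq,
    Matrix.smul_apply, PiLp.smul_apply, Complex.real_smul, smul_eq_mul, Function.comp_apply]
  ring

/-- Solutions on the line give smooth solutions of the radial equation. -/
lemma radial_solution_of_isSolution (hr₀ : r₀ ∈ Ioo B.rPlus B.rC) {μ e k lam : ℝ} {z : ℂ}
    {Y : ℝ → C2} (hY : IsSolution (B.tortoiseExpr μ e k lam r₀) z Y) :
    ContDiffOn ℝ ∞ (Y ∘ B.tortoise r₀) (Ioo B.rPlus B.rC) ∧ ∀ r ∈ Ioo B.rPlus B.rC,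
      B.radialExpr μ e k lam (Y ∘ B.tortoise r₀) r = z • (Y ∘ B.tortoise r₀) r := by
  set Φ := Y ∘ B.tortoise r₀ with hΦ
  have hd : DifferentiableOn ℝ Φ (Ioo B.rPlus B.rC) := fun r hr =>
    ((hY.1 _).comp r (B.hasDerivAt_tortoise hr₀ hr).differentiableAt).differentiableWithinAt
  have heq : Φ ∘ B.tortoiseInv r₀ = Y := by
    funext y
    simp [hΦ, B.tortoise_tortoiseInv hr₀]
  have hsol : ∀ r ∈ Ioo B.rPlus B.rC, B.radialExpr μ e k lam Φ r = z • Φ r := by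
    intro r hr
    have h := B.tortoiseExpr_comp hr₀ μ e k lam hd (B.tortoise r₀ r)
    rw [B.tortoiseInv_tortoise hr₀ hr, heq] at h
    rw [← h]
    exact hY.2 _
  refine ⟨?_, hsol⟩
  -- The equation solved for Φ' expresses it through Φ with smooth coefficients. Each order of
  -- differentiability of Φ therefore yields the next, starting from continuity.
  have hder : ∀ r ∈ Ioo B.rPlus B.rC,
      deriv Φ r 0 = B.radialWeight r * (B.radialV μ e k lam r 0 1 * Φ r 0 -
        (z - B.radialV μ e k lam r 1 1) * Φ r 1) ∧
      deriv Φ r 1 = B.radialWeight r * ((z - B.radialV μ e k lam r 0 0) * Φ r 0 -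
        B.radialV μ e k lam r 0 1 * Φ r 1) := by
    intro r hr
    have hw : (B.radialWeight r : ℂ) * (((B.radialWeight r)⁻¹ : ℝ) : ℂ) = 1 := by
      rw [← Complex.ofReal_mul, mul_inv_cancel₀ (B.radialWeight_pos hr).ne', Complex.ofReal_one]
    have s0 := congrArg (fun v : C2 => v 0) (hsol r hr)
    have s1 := congrArg (fun v : C2 => v 1) (hsol r hr)
    simp only [radialExpr, firstOrder_apply, radialA_eq, symplecticJ, Matrix.smul_apply,
      PiLp.smul_apply, smul_eq_mul, Matrix.of_apply, Matrix.cons_val', Matrix.cons_val_zero,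
      Matrix.cons_val_one, Matrix.cons_val_fin_one] at s0 s1
    have hs := B.radialV_symm μ e k lam r
    constructor
    · rw [hs]
      linear_combination -deriv Φ r 0 * hw - B.radialWeight r * s1
    · linear_combination -deriv Φ r 1 * hw + B.radialWeight r * s0
  have hw : ContDiffOn ℝ ∞ (fun r => (B.radialWeight r : ℂ)) (Ioo B.rPlus B.rC) :=
    Complex.ofRealCLM.contDiff.comp_contDiffOn B.contDiffOn_radialWeight
  have hV := fun i j => B.contDiffOn_radialV_entry μ e k lam i j
  refine contDiffOn_infty.2 fun n => ?_
  induction n with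
  | zero => exact contDiffOn_zero.2 hd.continuousOn
  | succ n ih =>
    rw [Nat.cast_succ, contDiffOn_succ_iff_deriv_of_isOpen isOpen_Ioo]
    refine ⟨hd, by simp, ?_⟩
    have hn : ((n : ℕ∞) : WithTop ℕ∞) ≤ ((⊤ : ℕ∞) : WithTop ℕ∞) := by exact_mod_cast le_top
    have hw' := hw.of_le hn
    have hV' := fun i j => (hV i j).of_le hn
    have ihc := (contDiffOn_piLp 2).1 ih
    refine (contDiffOn_piLp 2).2 fun i => ?_
    fin_cases i
    · refine ContDiffOn.congr ?_ fun r hr => (hder r hr).1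
      exact hw'.mul (((hV' 0 1).mul (ihc 0)).sub ((contDiffOn_const.sub (hV' 1 1)).mul (ihc 1)))
    · refine ContDiffOn.congr ?_ fun r hr => (hder r hr).2
      exact hw'.mul (((contDiffOn_const.sub (hV' 0 0)).mul (ihc 0)).sub ((hV' 0 1).mul (ihc 1)))

theorem essentiallySelfAdjoint_radialOp (μ e k lam : ℝ) :
    EssentiallySelfAdjoint (B.radialOp μ e k lam) := by
  obtain ⟨r₀, hr₀⟩ := nonempty_Ioo.2 B.rPlus_lt
  obtain ⟨C, hC⟩ := B.exists_norm_radialV_le μ e k lam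
  refine essentiallySelfAdjoint_minimalOp B.rPlus_lt B.measurable_radialWeight
    (fun r hr => B.radialWeight_pos hr) B.contDiffOn_radialWeight.continuousOn
    B.continuousOn_radialA (B.continuousOn_radialV μ e k lam)
    (fun r hr => B.not_integrableOn_radialWeight_right hr)
    (fun r hr => B.not_integrableOn_radialWeight_left hr)
    (fun r hr => B.radialWeight_smul_radialA hr)
    (B.radialV_conj μ e k lam) (B.radialV_symm μ e k lam) fun z => ?_
  obtain ⟨Y, Z, hY, hZ, hW⟩ := exists_fundamental_system
    (B.continuous_radialV_tortoiseInv hr₀ μ e k lam)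
    (fun t i j => hC _ (B.tortoiseInv_mem hr₀ t) i j)
    (fun t => B.radialV_symm μ e k lam _) z
  obtain ⟨hΦ, hΦs⟩ := B.radial_solution_of_isSolution hr₀ hY
  obtain ⟨hΨ, hΨs⟩ := B.radial_solution_of_isSolution hr₀ hZ
  exact ⟨_, _, hΦ, hΨ, hΦs, hΨs, fun r _ => hW _⟩

/-! ### The angular operator -/

/-- Here wA has off-diagonal entries i sin θ, with derivative i cos θ. In wB - (wB)* the b_k terms
and the real diagonal cancel, while the two halves of cot θ add up to i cos θ. -/
theorem angularOp_isFormalAdjoint (μ e k : ℝ) :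
    (B.angularOp μ e k).IsFormalAdjoint (B.angularOp μ e k) := by
  have hwA : ∀ θ, (B.angularWeight θ : ℂ) * (Complex.I * ((√(B.Δθ θ) : ℝ) : ℂ)) =
      Complex.I * ((Real.sin θ : ℝ) : ℂ) := by
    intro θ
    have h1 : B.angularWeight θ * √(B.Δθ θ) = Real.sin θ :=
      div_mul_cancel₀ _ (Real.sqrt_pos.2 (B.Δθ_pos θ)).ne'
    rw [← h1]
    push_cast
    ring
  have hentry : ∀ θ, ∀ i j, (B.angularWeight θ : ℂ) * B.angularA θ i j =
      if i = j then 0 else Complex.I * ((Real.sin θ : ℝ) : ℂ) := by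
    intro θ i j
    rw [← hwA]
    fin_cases i <;> fin_cases j <;> simp [angularA]
  refine minimalOp_isFormalAdjoint ?_ ?_ ?_ ?_
  · unfold angularWeight Δθ
    fun_prop
  · exact fun θ hθ => div_pos (Real.sin_pos_of_mem_Ioo hθ) (Real.sqrt_pos.2 (B.Δθ_pos θ))
  · intro θ _ i j
    rw [hentry, hentry]
    fin_cases i <;> fin_cases j <;> simp [-Complex.ofReal_sin, Complex.conj_ofReal]
  · intro θ hθ i j
    simp only [hentry]
    have hs : HasDerivAt (fun θ => Complex.I * ((Real.sin θ : ℝ) : ℂ))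
        (Complex.I * ((Real.cos θ : ℝ) : ℂ)) θ :=
      (Real.hasDerivAt_sin θ).ofReal_comp.const_mul _
    have hcot : B.angularWeight θ * (√(B.Δθ θ) * Real.cot θ) = Real.cos θ := by
      have h1 := (Real.sqrt_pos.2 (B.Δθ_pos θ)).ne'
      have h2 := (Real.sin_pos_of_mem_Ioo hθ).ne'
      rw [angularWeight, Real.cot_eq_cos_div_sin]
      field_simp
    have hcot' : (B.angularWeight θ : ℂ) * (((√(B.Δθ θ) : ℝ) : ℂ) * ((Real.cot θ : ℝ) : ℂ)) =
        ((Real.cos θ : ℝ) : ℂ) := by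
      exact_mod_cast hcot
    fin_cases i <;> fin_cases j
    · refine (hasDerivAt_const θ (0 : ℂ)).congr_deriv ?_
      simp [angularB, -Complex.ofReal_cos, Complex.conj_ofReal]
    · refine hs.congr_deriv ?_
      rw [← hcot']
      simp only [angularB, map_mul, Complex.conj_ofReal, Matrix.of_apply, Matrix.cons_val',
        Matrix.cons_val_zero, Matrix.cons_val_one, Matrix.cons_val_fin_one, Complex.conj_I,
        Fin.zero_eta, Fin.mk_one]
      push_cast
      ring
    · refine hs.congr_deriv ?_
      rw [← hcot']
      simp only [angularB, map_mul, Complex.conj_ofReal, Matrix.of_apply, Matrix.cons_val',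
        Matrix.cons_val_zero, Matrix.cons_val_one, Matrix.cons_val_fin_one, Complex.conj_I,
        Fin.zero_eta, Fin.mk_one]
      push_cast
      ring
    · refine (hasDerivAt_const θ (0 : ℂ)).congr_deriv ?_
      simp [angularB, -Complex.ofReal_cos, Complex.conj_ofReal]

end KNdS

/-! ### Conclusion for the Kerr–Newman–de Sitter operators -/

theorem theorem1 (B : KNdS) (μ e k : ℝ) (hk : ∃ n : ℤ, k = (n : ℝ) + 1 / 2) :
    (∀ z : ℂ, IsEigenvalue (B.angularOp μ e k).closure z → ∃ lam : ℝ, z = (lam : ℂ)) ∧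
    ∀ lam : ℝ,
      EssentiallySelfAdjoint (B.radialOp μ e k lam) ∧
      ∀ r₀ ∈ Ioo B.rPlus B.rC,
        (BijOn (B.tortoise r₀) (Ioo B.rPlus B.rC) univ ∧
          Tendsto (B.tortoise r₀) (𝓝[<] B.rC) atTop ∧
          Tendsto (B.tortoise r₀) (𝓝[>] B.rPlus) atBot) ∧
        (∀ X : ℝ → C2, DifferentiableOn ℝ X (Ioo B.rPlus B.rC) →
          ∀ y : ℝ, B.tortoiseExpr μ e k lam r₀ (X ∘ B.tortoiseInv r₀) y =
            B.radialExpr μ e k lam X (B.tortoiseInv r₀ y)) ∧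
        LimitPointAtTop (B.tortoiseExpr μ e k lam r₀) ∧
        LimitPointAtBot (B.tortoiseExpr μ e k lam r₀) := by
  refine ⟨fun z hz => (B.angularOp_isFormalAdjoint μ e k).closure_self.eigenvalue_real hz,
    fun lam => ⟨B.essentiallySelfAdjoint_radialOp μ e k lam, fun r₀ hr₀ => ?_⟩⟩
  obtain ⟨C, hC⟩ := B.exists_norm_radialV_le μ e k lam
  exact ⟨⟨B.bijOn_tortoise hr₀, B.tendsto_tortoise_rC hr₀, B.tendsto_tortoise_rPlus hr₀⟩,
    fun X hX y => B.tortoiseExpr_comp hr₀ μ e k lam hX y,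
    limitPointAtTop_diracLine (B.continuous_radialV_tortoiseInv hr₀ μ e k lam)
      (fun t i j => hC _ (B.tortoiseInv_mem hr₀ t) i j) fun t => B.radialV_symm μ e k lam _,
    limitPointAtBot_diracLine (B.continuous_radialV_tortoiseInv hr₀ μ e k lam)
      (fun t i j => hC _ (B.tortoiseInv_mem hr₀ t) i j) fun t => B.radialV_symm μ e k lam _⟩
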